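/- **Setting.** Let $X$ be a compact space with a finite measure $\rho$ and let $k:X\times X\to\mathbb R$ be a continuous, symmetric, positive semidefinite kernel with reproducing kernel Hilbert space $\mathcal H$. Let $L f=\int_X k(\cdot,y)f(y)\,d\rho(y)$ on $L^2(\rho)$, let $\mu_1\ge\mu_2\ge\dots\ge 0$ be its eigenvalues in decreasing order, counted with multiplicity (with $\mu_j=0$ if there are fewer than $j$ positive eigenvalues), and let $(e_j)$ be orthonormal eigenfunctions for the positive eigenvalues. For $s\in\mathbb R$ put $\|f\|_{\mathcal H^s}^2=\sum_{j:\mu_j>0}\mu_j^{-s}\langle f,e_j\rangle^2\in[0,\infty]$ for $f$ in the closed span of these $e_j$ in $L^2(\rho)$ and $\|f\|_{\mathcal H^s}=\infty$ for all other $f\in L^2(\rho)$, and let $\mathcal H^s=\{f:\|f\|_{\mathcal H^s}<\infty\}$; for $s\ge1$ the elements of $\mathcal H^s$ are identified with their continuous representatives. Given points $x_1,\dots,x_n\in X$ $(n\ge1)$, weights $q(x_i)>0$ and a target $f^*$, the noiseless kernel ridge regression solution is, for $\lambda>0$, $$\hat f_\lambda=\operatorname*{argmin}_{f\in\mathcal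 H}\ \frac1n\sum_{i=1}^n\frac1{q(x_i)}\bigl(f(x_i)-f^*(x_i)\bigr)^2+\lambda\|f\|_{\mathcal H}^2 ,$$ and $\hat f_0$ is the element of minimal $\mathcal H$-norm among all $f\in\mathcal H$ with $f(x_i)=f^*(x_i)$ for all $i$ (standard kernel ridge regression is $q\equiv1$). **Theorem.** (a) Let $d\ge2$. There is a positive integer $C$, depending only on $d$, such that for every continuous dot-product kernel $k(x,x')=\kappa(x^\top x')$ on $\mathbb S^{d-1}$ with the uniform probability distribution, all $n\ge1$, all $x_1,\dots,x_n\in\mathbb S^{d-1}$, all weights $q(x_i)>0$, all $0\le p\le2$, $s>2$ and $\lambda\ge0$ (with $\mu_{Cn}>0$ in the case $p=2$), $$\sup_{f^*\in\mathcal H^s}\|\hat f_\lambda-f^*\|_{\mathcal H^p}^2\ \ge\ \tfrac12\,\mu_{Cn}^{2-p}.\tag{1}$$ If, moreover, the eigenvalue $\lambda_k$ of $L$ on the spherical harmonics of degree $k$ is nonincreasing in $k$, then the supremum may be restricted to a ball of scale-invariant radius: $$\sup_{f^*\in\mathcal H^s,\ \|f^*\|_{\mathcal H^s}^2\le\mu_1^{2-s}}\|\hat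 f_\lambda-f^*\|_{\mathcal H^p}^2\ \ge\ \tfrac12\,\mu_{Cn}^{2-p}.\tag{2}$$ (b) There is an absolute positive integer $C$ such that (1) holds in the same way for every continuous periodic kernel $k(x,x')=\kappa(x-x')$ on $\mathbb T=\mathbb R/\mathbb Z$ with the uniform probability distribution, and all $n$, $x_1,\dots,x_n\in\mathbb T$, $q$, $p$, $s$, $\lambda$ as in (a). If, moreover, the Fourier coefficients $\int_{\mathbb T}\kappa(t)e^{-2\pi \mathrm i kt}\,dt$ $(k=0,1,2,\dots)$ are nonincreasing in $k$, then (2) holds as well. Thus adaptivity to smoothness saturates at $s=2$. -/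

import Mathlib

open MeasureTheory
open scoped ENNReal RealInnerProductSpace

noncomputable section

/-- A continuous (symmetric, positive semidefinite) kernel on a topological space. -/
structure PSDKernel (X : Type*) [TopologicalSpace X] where
  /-- The kernel as a function of two variables. -/
  toFun : X → X → ℝ
  continuous_toFun : Continuous fun z : X × X => toFun z.1 z.2
  symm : ∀ x y, toFun x y = toFun y x
  nonneg : ∀ (n : ℕ) (x : Fin n → X) (c : Fin n → ℝ),
    0 ≤ ∑ i, ∑ j, c i * c j * toFun (x i) (x j)

namespace PSDKernel

section RKHS

variable {X : Type*} [TopologicalSpace X] (K : PSDKernel X)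

/-- The kernel as an operator-valued matrix (a real number acts on `ℝ` by multiplication). -/
def opMatrix : Matrix X X (ℝ →L[ℝ] ℝ) :=
  Matrix.of fun x y => K.toFun x y • ContinuousLinearMap.id ℝ ℝ

theorem opMatrix_posSemidef : K.opMatrix.PosSemidef := by
  have key := (RKHS.posSemidef_tfae (K := K.opMatrix)).out 0 2
  refine key.mpr ⟨?_, fun v => ?_⟩
  · ext x y
    have h1 : ContinuousLinearMap.adjoint (ContinuousLinearMap.id ℝ ℝ) = ContinuousLinearMap.id ℝ ℝ :=
      (ContinuousLinearMap.eq_adjoint_iff _ _).mpr (fun _ _ => rfl) |>.symm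
    simp [opMatrix, Matrix.conjTranspose_apply, ContinuousLinearMap.star_eq_adjoint, K.symm y x, h1]
  · have h := K.nonneg v.support.card (fun i => (v.support.equivFin.symm i : X))
      (fun i => v (v.support.equivFin.symm i : X))
    have e : ∀ g : X → ℝ, ∑ i : Fin v.support.card, g (v.support.equivFin.symm i : X)
        = ∑ x ∈ v.support, g x := fun g => by
      rw [← Finset.sum_coe_sort v.support g]
      exact Equiv.sum_comp v.support.equivFin.symm (fun y : v.support => g (y : X))
    rw [e fun a => ∑ j, v a * v (v.support.equivFin.symm j : X) *
      K.toFun a (v.support.equivFin.symm j : X)] at h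
    simp_rw [fun a => e fun b => v a * v b * K.toFun a b] at h
    simp only [Finsupp.sum, opMatrix, Matrix.of_apply, smul_apply,
      ContinuousLinearMap.id_apply, smul_eq_mul, RCLike.inner_apply, conj_trivial, RCLike.re_to_real]
    refine h.trans_eq (Finset.sum_congr rfl fun a _ => Finset.sum_congr rfl fun b _ => ?_)
    rw [K.symm a b]
    ring

instance : Fact K.opMatrix.PosSemidef := ⟨K.opMatrix_posSemidef⟩

/-- The reproducing kernel Hilbert space of `K`; its elements coerce to functions `X → ℝ`. -/
abbrev NativeSpace : Type _ := RKHS.OfKernel K.opMatrix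

/-- The weighted, regularised empirical risk
`(1/n) ∑ᵢ (f(xᵢ) - yᵢ)² / q(xᵢ) + lam ‖f‖²`. -/
def risk {n : ℕ} (q : X → ℝ) (x : Fin n → X) (y : Fin n → ℝ) (lam : ℝ) (f : K.NativeSpace) : ℝ :=
  (1 / n : ℝ) * ∑ i, (1 / q (x i)) * (f (x i) - y i) ^ 2 + lam * ‖f‖ ^ 2

/-- `f` is the (weighted) kernel ridge regression solution: for `lam ≠ 0` it minimises the
regularised risk over the RKHS; for `lam = 0` it is the minimum-norm interpolant of the data. -/
def IsKRR {n : ℕ} (q : X → ℝ) (x : Fin n → X) (y : Fin n → ℝ) (lam : ℝ) (f : K.NativeSpace) :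
    Prop :=
  if lam = 0 then
    (∀ i, f (x i) = y i) ∧ ∀ g : K.NativeSpace, (∀ i, g (x i) = y i) → ‖f‖ ≤ ‖g‖
  else
    ∀ g : K.NativeSpace, K.risk q x y lam f ≤ K.risk q x y lam g

/-- The kernel ridge regression solution (the argmin). -/
def krr {n : ℕ} (q : X → ℝ) (x : Fin n → X) (y : Fin n → ℝ) (lam : ℝ) : K.NativeSpace :=
  Classical.epsilon (K.IsKRR q x y lam)

end RKHS

section Spectral

variable {X : Type*} [TopologicalSpace X] [CompactSpace X] (K : PSDKernel X)

theorem exists_bound : ∃ M : ℝ, ∀ x y, ‖K.toFun x y‖ ≤ M := by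
  obtain ⟨M, hM⟩ := isCompact_univ.exists_bound_of_continuousOn
    (f := fun z : X × X => K.toFun z.1 z.2) K.continuous_toFun.continuousOn
  exact ⟨M, fun x y => hM (x, y) (Set.mem_univ _)⟩

variable [MeasurableSpace X] [BorelSpace X] (ρ : Measure X) [IsFiniteMeasure ρ]

theorem integrable_mul (f : Lp ℝ 2 ρ) (x : X) : Integrable (fun y => K.toFun x y * f y) ρ := by
  obtain ⟨M, hM⟩ := K.exists_bound
  have hc : Continuous (K.toFun x) :=
    K.continuous_toFun.comp (by fun_prop : Continuous fun y : X => (x, y))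
  exact ((Lp.memLp f).integrable (by norm_num)).bdd_mul
    hc.aestronglyMeasurable (Filter.Eventually.of_forall fun y => hM x y)

variable [FirstCountableTopology X]

theorem continuous_integral (f : Lp ℝ 2 ρ) :
    Continuous fun x => ∫ y, K.toFun x y * f y ∂ρ := by
  obtain ⟨M, hM⟩ := K.exists_bound
  refine continuous_of_dominated (bound := fun y => M * ‖f y‖)
    (fun x => (K.integrable_mul ρ f x).aestronglyMeasurable)
    (fun x => Filter.Eventually.of_forall fun y => ?_)
    ((((Lp.memLp f).integrable (by norm_num)).norm).const_mul M)
    (Filter.Eventually.of_forall fun y => ?_)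
  · rw [norm_mul]
    exact mul_le_mul_of_nonneg_right (hM x y) (norm_nonneg _)
  · exact (K.continuous_toFun.comp (by fun_prop : Continuous fun x : X => (x, y))).mul
      continuous_const

/-- The integral operator `f ↦ ∫ K(·, y) f(y) dρ(y)` on `L²(ρ)`. -/
def integralOp : Lp ℝ 2 ρ →ₗ[ℝ] Lp ℝ 2 ρ where
  toFun f :=
    ContinuousMap.toLp 2 ρ ℝ ⟨fun x => ∫ y, K.toFun x y * f y ∂ρ, K.continuous_integral ρ f⟩
  map_add' f g := by
    rw [← map_add]
    congr 1
    ext x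
    simp only [ContinuousMap.coe_mk, ContinuousMap.add_apply]
    rw [← integral_add (K.integrable_mul ρ f x) (K.integrable_mul ρ g x)]
    refine integral_congr_ae ?_
    filter_upwards [Lp.coeFn_add f g] with y hy
    rw [hy, Pi.add_apply, mul_add]
  map_smul' c f := by
    rw [RingHom.id_apply, ← map_smul]
    congr 1
    ext x
    simp only [ContinuousMap.coe_mk, ContinuousMap.smul_apply, smul_eq_mul]
    rw [← integral_const_mul]
    refine integral_congr_ae ?_
    filter_upwards [Lp.coeFn_smul c f] with y hy
    rw [hy, Pi.smul_apply, smul_eq_mul, mul_left_comm]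

/-- The eigenspace of the integral operator for the eigenvalue `ν`, as a subspace of `L²(ρ)`. -/
def eigenspace (ν : ℝ) : Submodule ℝ (Lp ℝ 2 ρ) :=
  Module.End.eigenspace (K.integralOp ρ) ν

/-- The `j`-th largest eigenvalue `μ_j` of the integral operator (`j = 1, 2, …`), counted with
multiplicity: the largest `t > 0` such that the eigenvectors with eigenvalue at least `t` span a
space of dimension at least `j`; it is `0` if there are fewer than `j` positive eigenvalues. -/
def eigenvalue (j : ℕ) : ℝ :=
  sSup {t : ℝ | 0 < t ∧ (j : Cardinal) ≤ Module.rank ℝ ↥(⨆ ν ∈ Set.Ici t, K.eigenspace ρ ν)}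

/-- The squared norm `‖L^{-s/2} f‖²` on `L²(ρ)` with values in `[0, ∞]`, that is
`∑_ν ν^{-s} ‖P_ν f‖²`, the sum being over the positive eigenvalues `ν` of the integral operator `L`
and `P_ν` being the orthogonal projection onto the eigenspace of `ν`; it is `∞` outside the closed
span of the eigenvectors with positive eigenvalue. (The eigenspaces are closed, so that taking
their closure changes nothing; for all other `ν` the space and the summand are zero.) -/
def hsNormSqLp (s : ℝ) (f : Lp ℝ 2 ρ) : ℝ≥0∞ :=
  open scoped Classical in
  if f ∈ (⨆ ν ∈ Set.Ioi (0 : ℝ), K.eigenspace ρ ν).topologicalClosure then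
    ∑' ν : Set.Ioi (0 : ℝ), ENNReal.ofReal ((ν : ℝ) ^ (-s)) *
      ‖(K.eigenspace ρ ν).topologicalClosure.starProjection f‖ₑ ^ 2
  else ⊤

/-- The squared interpolation norm `‖f‖²` in `ℋ^s` of a function `f : X → ℝ`, in `[0, ∞]`. -/
def hsNormSq (s : ℝ) (f : X → ℝ) : ℝ≥0∞ :=
  open scoped Classical in
  if h : MemLp f 2 ρ then K.hsNormSqLp ρ s h.toLp else ⊤

/-- The squared `ℋ^p` error of noiseless kernel ridge regression for the target `f`. -/
def errorSq {n : ℕ} (q : X → ℝ) (x : Fin n → X) (lam p : ℝ) (f : C(X, ℝ)) : ℝ≥0∞ :=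
  K.hsNormSq ρ p fun t => K.krr q x (fun i => f (x i)) lam t - f t

/-- The supremum of the squared `ℋ^p` error over all targets `f ∈ ℋ^s` (each `f` being represented
by its continuous version, which exists for `s ≥ 1`). -/
def supErrorSq {n : ℕ} (q : X → ℝ) (x : Fin n → X) (lam s p : ℝ) : ℝ≥0∞ :=
  ⨆ f : {f : C(X, ℝ) // K.hsNormSq ρ s f < ⊤}, K.errorSq ρ q x lam p f.1

/-- The supremum of the squared `ℋ^p` error over all targets `f ∈ ℋ^s` whose squared `ℋ^s` norm
is at most `r`. -/
def ballErrorSq {n : ℕ} (q : X → ℝ) (x : Fin n → X) (lam s p r : ℝ) : ℝ≥0∞ :=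
  ⨆ f : {f : C(X, ℝ) // K.hsNormSq ρ s f ≤ ENNReal.ofReal r}, K.errorSq ρ q x lam p f.1

end Spectral

end PSDKernel

/-- The unit sphere `𝕊^{d-1}` in `ℝ^d`. -/
abbrev UnitSphere (d : ℕ) : Type := Metric.sphere (0 : EuclideanSpace ℝ (Fin d)) 1

/-- The uniform probability distribution on `𝕊^{d-1}` (normalised surface measure). -/
def uniformSphere (d : ℕ) : Measure (UnitSphere d) :=
  ((volume : Measure (EuclideanSpace ℝ (Fin d))).toSphere Set.univ)⁻¹ •
    (volume : Measure (EuclideanSpace ℝ (Fin d))).toSphere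

instance (d : ℕ) : IsFiniteMeasure (uniformSphere d) := by
  refine ⟨?_⟩
  rw [uniformSphere, Measure.smul_apply, smul_eq_mul]
  exact (ENNReal.inv_mul_le_one _).trans_lt ENNReal.one_lt_top

/-- `lam k` is the eigenvalue of the kernel `K` on the spherical harmonics of degree `k`, i.e. on
the restrictions to the sphere of the harmonic homogeneous polynomials of degree `k`. -/
def HasHarmonicEigenvalues {d : ℕ} (K : PSDKernel (UnitSphere d)) (lam : ℕ → ℝ) : Prop :=
  ∀ (k : ℕ) (Y : MvPolynomial (Fin d) ℝ), Y.IsHomogeneous k →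
    ∑ i, MvPolynomial.pderiv i (MvPolynomial.pderiv i Y) = 0 →
    ∀ x : UnitSphere d,
      ∫ y, K.toFun x y * MvPolynomial.eval (fun i => y.1 i) Y ∂(uniformSphere d) =
        lam k * MvPolynomial.eval (fun i => x.1 i) Y

/-- The eigenvalue `∫ κ(t) e^{-2πikt} dt` of the periodic kernel `κ(x - y)` on the frequency `k`. -/
def periodicEigenvalue (κ : UnitAddCircle → ℝ) (k : ℕ) : ℝ :=
  (fourierCoeff (fun t => (κ t : ℂ)) (k : ℤ)).re

end

/-!
Over the whole of `ℋ^s` the supremum is infinite as soon as the integral operator `L` has more than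
`n` positive eigenvalues (`PSDKernel.supErrorSq_eq_top`): some nonzero finite combination of
eigenfunctions vanishes at all `n` sample points, regression returns zero on each of its multiples,
and the error scales with the multiple.

On the ball of radius `μ₁^{2-s}` the target is the constant function `L 1 = μ₁`
(`PSDKernel.le_ballErrorSq_of_test`). By the representer theorem the regression function is
`∑ᵢ aᵢ K(xᵢ, ·)`, so that the error is `u = L(∑ᵢ aᵢ δ_{xᵢ} - ρ)`.
Let `g` be a function in the span of the eigenfunctions with eigenvalue at least `μ` that vanishes
at the sample points. Then `⟨u, L⁻¹ g⟩ = -∫ g dρ`, and the Cauchy–Schwarz inequality gives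
`‖u‖²_{ℋ^p} ≥ μ^{2-p} (∫ g)² / ∫ g²`. It remains to find `g` with `∫ g² ≤ 2 (∫ g)²` for
`μ = μ_{Cn}`.

Let `V` be the space of polynomials of degree at most `m` on the sphere or the torus, with
`N = dim V ≥ 2n`, and let `g = ∑ w_l²` for an orthonormal basis `w_l` of the space of those `f ∈ V`
that vanish at the sample points (`exists_test_function`). Then `∫ g ≥ N - n ≥ N / 2`. As the domain
is homogeneous, the diagonal of the reproducing kernel of `V` is the constant `N`
(`sq_apply_le_finrank_mul_integral`), hence `0 ≤ g ≤ N` and `∫ g² ≤ N ∫ g ≤ 2 (∫ g)²`.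

The function `g` is a polynomial of degree at most `2m`, and thus a sum of eigenfunctions with
eigenvalues at least `λ_{2m}`. The harmonics are complete (Stone–Weierstrass), so `μ_j ≤ λ_{2m}`
once `j` exceeds the dimension of the polynomials of degree at most `2m - 1`
(`PSDKernel.eigenvalue_le_of_finrank_lt`). For the least possible `m`, this dimension is less than
`Cn`, because doubling the degree multiplies the dimension of the space of polynomials by a bounded
factor only: see `finrank_torusPoly_le`, `finrank_torusPoly_ge`, `finrank_spherePoly_le` and
`finrank_le_finrank_spherePoly`. On the sphere the eigenvalues are given on harmonic polynomials;
every polynomial agrees with a sum of these on the sphere, by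
`MvPolynomial.exists_harmonic_add_radiusSq_mul`.
-/

set_option linter.unusedSectionVars false

noncomputable section

/-! ### The spectral decomposition of the integral operator -/

section ToLp
variable {X : Type*} [TopologicalSpace X] [CompactSpace X] [MeasurableSpace X] [BorelSpace X]
  [SecondCountableTopology X] (ρ : Measure X) [IsFiniteMeasure ρ]

theorem coe_toLp_ae (f : C(X, ℝ)) : ContinuousMap.toLp 2 ρ ℝ f =ᵐ[ρ] f :=
  ContinuousMap.coeFn_toLp ρ f

theorem inner_toLp_left (f : C(X, ℝ)) (g : Lp ℝ 2 ρ) :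
    ⟪ContinuousMap.toLp 2 ρ ℝ f, g⟫ = ∫ x, f x * g x ∂ρ := by
  rw [L2.inner_def]
  refine integral_congr_ae ?_
  filter_upwards [coe_toLp_ae ρ f] with x hx
  rw [hx, RCLike.inner_apply, conj_trivial, mul_comm]

theorem inner_toLp_toLp (f g : C(X, ℝ)) :
    ⟪ContinuousMap.toLp 2 ρ ℝ f, ContinuousMap.toLp 2 ρ ℝ g⟫ = ∫ x, f x * g x ∂ρ := by
  rw [inner_toLp_left]
  refine integral_congr_ae ?_
  filter_upwards [coe_toLp_ae ρ g] with x hx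
  rw [hx]

end ToLp

namespace PSDKernel
section Operator
variable {X : Type*} [TopologicalSpace X] [CompactSpace X] [SecondCountableTopology X]
  [MeasurableSpace X] [BorelSpace X] (K : PSDKernel X) (ρ : Measure X) [IsFiniteMeasure ρ]

/-- The continuous representative `x ↦ ∫ K(x, y) f(y) dρ(y)` of the image of `f` under the
integral operator. -/
def potential (f : Lp ℝ 2 ρ) : C(X, ℝ) :=
  ⟨fun x => ∫ y, K.toFun x y * f y ∂ρ, K.continuous_integral ρ f⟩

theorem integralOp_eq_toLp_potential (f : Lp ℝ 2 ρ) :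
    K.integralOp ρ f = ContinuousMap.toLp 2 ρ ℝ (K.potential ρ f) := rfl

theorem potential_toLp_apply (f : C(X, ℝ)) (x : X) :
    K.potential ρ (ContinuousMap.toLp 2 ρ ℝ f) x = ∫ y, K.toFun x y * f y ∂ρ := by
  refine integral_congr_ae ?_
  filter_upwards [coe_toLp_ae ρ f] with y hy
  rw [hy]

theorem integralOp_symm (f g : Lp ℝ 2 ρ) :
    ⟪K.integralOp ρ f, g⟫ = ⟪f, K.integralOp ρ g⟫ := by
  rw [real_inner_comm (K.integralOp ρ g), integralOp_eq_toLp_potential,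
    integralOp_eq_toLp_potential, inner_toLp_left, inner_toLp_left]
  have hf : Integrable f ρ := (Lp.memLp f).integrable (by norm_num)
  have hg : Integrable g ρ := (Lp.memLp g).integrable (by norm_num)
  obtain ⟨M, hM⟩ := K.exists_bound
  have hint : Integrable (Function.uncurry fun x y => K.toFun x y * (g x * f y)) (ρ.prod ρ) :=
    (hg.mul_prod hf).bdd_mul (f := fun z : X × X => K.toFun z.1 z.2) (c := M)
      K.continuous_toFun.aestronglyMeasurable (Filter.Eventually.of_forall fun z => hM z.1 z.2)
  calc ∫ x, (∫ y, K.toFun x y * f y ∂ρ) * g x ∂ρ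
      = ∫ x, ∫ y, K.toFun x y * (g x * f y) ∂ρ ∂ρ := by
        refine integral_congr_ae (Filter.Eventually.of_forall fun x => ?_)
        simp only
        rw [← integral_mul_const]
        refine integral_congr_ae (Filter.Eventually.of_forall fun y => ?_)
        simp only; ring
    _ = ∫ y, ∫ x, K.toFun x y * (g x * f y) ∂ρ ∂ρ := integral_integral_swap hint
    _ = ∫ x, (∫ y, K.toFun x y * g y ∂ρ) * f x ∂ρ := by
        refine integral_congr_ae (Filter.Eventually.of_forall fun x => ?_)
        simp only
        rw [← integral_mul_const]
        refine integral_congr_ae (Filter.Eventually.of_forall fun y => ?_)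
        simp only; rw [K.symm y x]; ring

theorem mem_eigenspace {ν : ℝ} {f : Lp ℝ 2 ρ} :
    f ∈ K.eigenspace ρ ν ↔ K.integralOp ρ f = ν • f :=
  Module.End.mem_eigenspace_iff

theorem inner_eq_zero_of_mem_eigenspace {ν ν' : ℝ} (h : ν ≠ ν') {f g : Lp ℝ 2 ρ}
    (hf : f ∈ K.eigenspace ρ ν) (hg : g ∈ K.eigenspace ρ ν') : ⟪f, g⟫ = 0 := by
  rw [mem_eigenspace] at hf hg
  have := K.integralOp_symm ρ f g
  rw [hf, hg, real_inner_smul_left, real_inner_smul_right] at this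
  have h2 : (ν - ν') * ⟪f, g⟫ = 0 := by linarith
  exact (mul_eq_zero.mp h2).resolve_left (sub_ne_zero.mpr h)

/-- The span of the eigenvectors with eigenvalue at least `t`. -/
def spectralSpan (t : ℝ) : Submodule ℝ (Lp ℝ 2 ρ) := ⨆ ν ∈ Set.Ici t, K.eigenspace ρ ν

theorem eigenspace_le_spectralSpan {t ν : ℝ} (h : t ≤ ν) :
    K.eigenspace ρ ν ≤ K.spectralSpan ρ t :=
  le_biSup (fun ν => K.eigenspace ρ ν) (Set.mem_Ici.mpr h)

/-- Elements of the spectral span are finite sums of eigenvectors. -/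
theorem exists_eigen_decomposition {t : ℝ} {f : Lp ℝ 2 ρ} (hf : f ∈ K.spectralSpan ρ t) :
    ∃ (s : Finset ℝ) (F : ℝ → Lp ℝ 2 ρ), (∀ ν ∈ s, t ≤ ν) ∧ (∀ ν, F ν ∈ K.eigenspace ρ ν) ∧
      f = ∑ ν ∈ s, F ν := by
  classical
  rw [spectralSpan, iSup_subtype', Submodule.mem_iSup_iff_exists_finsupp] at hf
  obtain ⟨F, hF, rfl⟩ := hf
  refine ⟨F.support.map (Function.Embedding.subtype _),
    fun ν => if h : t ≤ ν then F ⟨ν, h⟩ else 0, ?_, ?_, ?_⟩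
  · intro ν hν
    obtain ⟨a, -, rfl⟩ := Finset.mem_map.mp hν
    exact a.2
  · intro ν
    by_cases h : t ≤ ν
    · simpa [h] using hF ⟨ν, h⟩
    · simp [h]
  · rw [Finset.sum_map, Finsupp.sum]
    refine Finset.sum_congr rfl fun a _ => ?_
    have : t ≤ (a : ℝ) := a.2
    simp [this]

theorem starProjection_eigenspace_of_mem {ν : ℝ} {f : Lp ℝ 2 ρ} (hf : f ∈ K.eigenspace ρ ν) :
    (K.eigenspace ρ ν).topologicalClosure.starProjection f = f :=
  Submodule.starProjection_eq_self_iff.mpr (Submodule.le_topologicalClosure _ hf)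

theorem starProjection_eigenspace_of_ne {ν ν' : ℝ} (h : ν' ≠ ν) {f : Lp ℝ 2 ρ}
    (hf : f ∈ K.eigenspace ρ ν') :
    (K.eigenspace ρ ν).topologicalClosure.starProjection f = 0 := by
  rw [Submodule.starProjection_apply_eq_zero_iff, Submodule.orthogonal_closure,
    Submodule.mem_orthogonal]
  exact fun g hg => K.inner_eq_zero_of_mem_eigenspace ρ h.symm hg hf

theorem inner_starProjection_eigenspace {ν : ℝ} (u : Lp ℝ 2 ρ) {g : Lp ℝ 2 ρ}
    (hg : g ∈ K.eigenspace ρ ν) :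
    ⟪(K.eigenspace ρ ν).topologicalClosure.starProjection u, g⟫ = ⟪u, g⟫ := by
  rw [Submodule.inner_starProjection_left_eq_right, K.starProjection_eigenspace_of_mem ρ hg]

/-- Finitely many spectral components bound the interpolation norm from below. -/
theorem le_hsNormSqLp (s : ℝ) (f : Lp ℝ 2 ρ) (T : Finset ℝ) (hT : ∀ ν ∈ T, 0 < ν) :
    ∑ ν ∈ T, ENNReal.ofReal (ν ^ (-s)) *
      ‖(K.eigenspace ρ ν).topologicalClosure.starProjection f‖ₑ ^ 2 ≤ K.hsNormSqLp ρ s f := by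
  classical
  rw [hsNormSqLp]
  split_ifs with h
  · refine le_trans (le_of_eq ?_) (ENNReal.sum_le_tsum (T.subtype (· ∈ Set.Ioi (0:ℝ))))
    rw [Finset.sum_subtype_of_mem (p := (· ∈ Set.Ioi (0 : ℝ)))
      (fun ν : ℝ => ENNReal.ofReal (ν ^ (-s)) *
      ‖(K.eigenspace ρ ν).topologicalClosure.starProjection f‖ₑ ^ 2) hT]
  · exact le_top

theorem spectralSpan_le {t : ℝ} (ht : 0 < t) :
    K.spectralSpan ρ t ≤ ⨆ ν ∈ Set.Ioi (0 : ℝ), K.eigenspace ρ ν :=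
  iSup₂_le fun _ hν => le_biSup (fun ν => K.eigenspace ρ ν)
    (Set.mem_Ioi.mpr (ht.trans_le hν))

theorem hsNormSqLp_lt_top {t : ℝ} (ht : 0 < t) (s : ℝ) {f : Lp ℝ 2 ρ}
    (hf : f ∈ K.spectralSpan ρ t) : K.hsNormSqLp ρ s f < ⊤ := by
  classical
  have hmem := Submodule.le_topologicalClosure _ (K.spectralSpan_le ρ ht hf)
  rw [hsNormSqLp, if_pos hmem]
  obtain ⟨T, F, hT, hF, rfl⟩ := K.exists_eigen_decomposition ρ hf
  rw [tsum_eq_sum (s := T.subtype (· ∈ Set.Ioi (0:ℝ)))]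
  · exact ENNReal.sum_lt_top.mpr fun ν _ => ENNReal.mul_lt_top ENNReal.ofReal_lt_top
      (ENNReal.pow_lt_top enorm_lt_top)
  · intro ν hν
    have hν' : (ν : ℝ) ∉ T := by simpa using hν
    rw [map_sum, Finset.sum_eq_zero, enorm_zero]
    · simp
    · intro ν' h'
      exact K.starProjection_eigenspace_of_ne ρ (fun h => hν' (by rwa [← h])) (hF ν')

theorem hsNormSqLp_of_mem_eigenspace {ν : ℝ} (hν : 0 < ν) (s : ℝ) {f : Lp ℝ 2 ρ}
    (hf : f ∈ K.eigenspace ρ ν) :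
    K.hsNormSqLp ρ s f = ENNReal.ofReal (ν ^ (-s) * ‖f‖ ^ 2) := by
  classical
  have hmem := Submodule.le_topologicalClosure _
    (le_biSup (fun ν => K.eigenspace ρ ν) (Set.mem_Ioi.mpr hν) hf)
  rw [hsNormSqLp, if_pos hmem, tsum_eq_single (⟨ν, hν⟩ : Set.Ioi (0:ℝ))]
  · rw [K.starProjection_eigenspace_of_mem ρ hf, ENNReal.ofReal_mul (by positivity),
      ENNReal.ofReal_pow (norm_nonneg _), ofReal_norm]
  · intro ν' h'
    rw [K.starProjection_eigenspace_of_ne ρ (fun h => h' (Subtype.ext h.symm)) hf]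
    simp

/-- The Cauchy–Schwarz inequality for the duality between `ℋ^p` and `ℋ^{2-p}` in the inner product
of the native space, tested against a finite sum of eigenvectors with eigenvalues at least `μ`. -/
theorem ofReal_le_hsNormSqLp {μ p B : ℝ} (hμ : 0 < μ) (hp : p ≤ 2) (hB : 0 < B) (u : Lp ℝ 2 ρ)
    (T : Finset ℝ) (hT : ∀ ν ∈ T, μ ≤ ν) (F : ℝ → Lp ℝ 2 ρ) (hF : ∀ ν, F ν ∈ K.eigenspace ρ ν)
    (hFB : ∑ ν ∈ T, ‖F ν‖ ^ 2 ≤ B) :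
    ENNReal.ofReal ((∑ ν ∈ T, ν⁻¹ * ⟪u, F ν⟫) ^ 2 / B * μ ^ (2 - p)) ≤ K.hsNormSqLp ρ p u := by
  have hT0 : ∀ ν ∈ T, 0 < ν := fun ν h => hμ.trans_le (hT ν h)
  refine le_trans ?_ (K.le_hsNormSqLp ρ p u T hT0)
  set P : ℝ → Lp ℝ 2 ρ := fun ν => (K.eigenspace ρ ν).topologicalClosure.starProjection u with hP
  have key : ∀ ν ∈ T, ENNReal.ofReal (ν ^ (-p)) * ‖P ν‖ₑ ^ 2
      = ENNReal.ofReal (ν ^ (-p) * ‖P ν‖ ^ 2) := fun ν hν => by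
    rw [ENNReal.ofReal_mul (Real.rpow_nonneg (hT0 ν hν).le _),
      ENNReal.ofReal_pow (norm_nonneg _), ofReal_norm]
  rw [Finset.sum_congr rfl key, ← ENNReal.ofReal_sum_of_nonneg
    fun ν hν => mul_nonneg (Real.rpow_nonneg (hT0 ν hν).le _) (sq_nonneg _)]
  refine ENNReal.ofReal_le_ofReal ?_
  rw [div_mul_eq_mul_div, div_le_iff₀ hB]
  have h1 : |∑ ν ∈ T, ν⁻¹ * ⟪u, F ν⟫| ≤
      ∑ ν ∈ T, (ν ^ (-p / 2) * ‖P ν‖) * (ν ^ ((p - 2) / 2) * ‖F ν‖) := by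
    refine (Finset.abs_sum_le_sum_abs _ _).trans (Finset.sum_le_sum fun ν hν => ?_)
    have h0 := hT0 ν hν
    rw [abs_mul, abs_of_pos (inv_pos.mpr h0), ← K.inner_starProjection_eigenspace ρ u (hF ν)]
    have e : ν⁻¹ = ν ^ (-p / 2) * ν ^ ((p - 2) / 2) := by
      rw [← Real.rpow_add h0, ← Real.rpow_neg_one]; congr 1; ring
    rw [e]
    have := abs_real_inner_le_norm (P ν) (F ν)
    calc _ ≤ ν ^ (-p / 2) * ν ^ ((p - 2) / 2) * (‖P ν‖ * ‖F ν‖) := by gcongr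
      _ = _ := by ring
  have h2 : (∑ ν ∈ T, ν⁻¹ * ⟪u, F ν⟫) ^ 2 ≤
      (∑ ν ∈ T, ν ^ (-p) * ‖P ν‖ ^ 2) * ∑ ν ∈ T, ν ^ (p - 2) * ‖F ν‖ ^ 2 := by
    rw [← sq_abs]
    refine (pow_le_pow_left₀ (abs_nonneg _) h1 2).trans
      ((Finset.sum_mul_sq_le_sq_mul_sq _ _ _).trans_eq ?_)
    congr 1 <;> refine Finset.sum_congr rfl fun ν hν => ?_
    · rw [mul_pow, ← Real.rpow_natCast (ν ^ _), ← Real.rpow_mul (hT0 ν hν).le]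
      congr 2; push_cast; ring
    · rw [mul_pow, ← Real.rpow_natCast (ν ^ _), ← Real.rpow_mul (hT0 ν hν).le]
      congr 2; push_cast; ring
  have h3 : (∑ ν ∈ T, ν ^ (p - 2) * ‖F ν‖ ^ 2) * μ ^ (2 - p) ≤ B := by
    refine le_trans ?_ hFB
    rw [Finset.sum_mul]
    refine Finset.sum_le_sum fun ν hν => ?_
    have h0 := hT0 ν hν
    have : ν ^ (p - 2) * μ ^ (2 - p) ≤ 1 := by
      rw [show p - 2 = -(2 - p) by ring, Real.rpow_neg h0.le, inv_mul_le_iff₀ (by positivity),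
        mul_one]
      exact Real.rpow_le_rpow hμ.le (hT ν hν) (by linarith)
    nlinarith [sq_nonneg ‖F ν‖]
  have h4 : 0 ≤ ∑ ν ∈ T, ν ^ (-p) * ‖P ν‖ ^ 2 :=
    Finset.sum_nonneg fun ν hν => mul_nonneg (Real.rpow_nonneg (hT0 ν hν).le _) (sq_nonneg _)
  calc _ ≤ ((∑ ν ∈ T, ν ^ (-p) * ‖P ν‖ ^ 2) * ∑ ν ∈ T, ν ^ (p - 2) * ‖F ν‖ ^ 2) * μ ^ (2 - p) := by
        gcongr
    _ = (∑ ν ∈ T, ν ^ (-p) * ‖P ν‖ ^ 2) * ((∑ ν ∈ T, ν ^ (p - 2) * ‖F ν‖ ^ 2) * μ ^ (2 - p)) := by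
        ring
    _ ≤ _ := by gcongr

theorem norm_sq_sum_eigenvectors (T : Finset ℝ) (F : ℝ → Lp ℝ 2 ρ)
    (hF : ∀ ν, F ν ∈ K.eigenspace ρ ν) :
    ‖∑ ν ∈ T, F ν‖ ^ 2 = ∑ ν ∈ T, ‖F ν‖ ^ 2 := by
  classical
  rw [← real_inner_self_eq_norm_sq, sum_inner]
  refine Finset.sum_congr rfl fun ν hν => ?_
  rw [inner_sum, Finset.sum_eq_single_of_mem ν hν, real_inner_self_eq_norm_sq]
  exact fun ν' _ h => K.inner_eq_zero_of_mem_eigenspace ρ h.symm (hF ν) (hF ν')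

end Operator
end PSDKernel

/-! ### Kernel ridge regression and the representer theorem -/

namespace PSDKernel
section Regression
variable {X : Type*} [TopologicalSpace X] (K : PSDKernel X)

/-- The kernel section `K(·, x)` as an element of the native space. -/
def kernelSection (x : X) : K.NativeSpace := RKHS.kerFun K.NativeSpace x (1 : ℝ)

theorem inner_kernelSection (x : X) (f : K.NativeSpace) : ⟪K.kernelSection x, f⟫ = f x := by
  rw [kernelSection, RKHS.kerFun_inner]
  simp

theorem kernelSection_apply (y x : X) : K.kernelSection y x = K.toFun x y := by
  rw [kernelSection, RKHS.kerFun_apply, RKHS.OfKernel.kernel_ofKernel]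
  simp [opMatrix]

/-- The span of the kernel sections at the sample points. -/
def sampleSpan {n : ℕ} (x : Fin n → X) : Submodule ℝ K.NativeSpace :=
  Submodule.span ℝ (Set.range fun i => K.kernelSection (x i))

instance {n : ℕ} (x : Fin n → X) : FiniteDimensional ℝ (K.sampleSpan x) :=
  FiniteDimensional.span_of_finite ℝ (Set.finite_range _)

theorem exists_apply_eq_of_mem_sampleSpan {n : ℕ} {x : Fin n → X} {f : K.NativeSpace}
    (hf : f ∈ K.sampleSpan x) :
    ∃ a : Fin n → ℝ, ∀ t, f t = ∑ i, a i * K.toFun (x i) t := by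
  obtain ⟨a, rfl⟩ := (Submodule.mem_span_range_iff_exists_fun ℝ).mp hf
  refine ⟨a, fun t => ?_⟩
  rw [← K.inner_kernelSection, inner_sum]
  refine Finset.sum_congr rfl fun i _ => ?_
  rw [real_inner_smul_right, K.inner_kernelSection, K.kernelSection_apply, K.symm]

/-- Projecting onto the span of the kernel sections does not change the values at the sample
points. -/
theorem starProjection_sampleSpan_apply {n : ℕ} (x : Fin n → X) (f : K.NativeSpace) (i : Fin n) :
    (K.sampleSpan x).starProjection f (x i) = f (x i) := by
  have hi : K.kernelSection (x i) ∈ K.sampleSpan x := Submodule.subset_span ⟨i, rfl⟩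
  rw [← K.inner_kernelSection, ← K.inner_kernelSection,
    ← Submodule.inner_starProjection_left_eq_right, Submodule.starProjection_eq_self_iff.mpr hi]

theorem norm_sq_eq_add_starProjection (S : Submodule ℝ K.NativeSpace) [S.HasOrthogonalProjection]
    (f : K.NativeSpace) : ‖f‖ ^ 2 = ‖S.starProjection f‖ ^ 2 + ‖f - S.starProjection f‖ ^ 2 := by
  have h := norm_add_sq_real (S.starProjection f) (f - S.starProjection f)
  have h0 : ⟪S.starProjection f, f - S.starProjection f⟫ = 0 :=
    Submodule.inner_right_of_mem_orthogonal (Submodule.starProjection_apply_mem S f)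
      (Submodule.sub_starProjection_mem_orthogonal f)
  rw [add_sub_cancel, h0] at h
  linarith

theorem risk_starProjection {n : ℕ} (q : X → ℝ) (x : Fin n → X) (y : Fin n → ℝ) (lam : ℝ)
    (f : K.NativeSpace) :
    K.risk q x y lam ((K.sampleSpan x).starProjection f) +
      lam * ‖f - (K.sampleSpan x).starProjection f‖ ^ 2 = K.risk q x y lam f := by
  simp only [risk, K.starProjection_sampleSpan_apply x]
  rw [K.norm_sq_eq_add_starProjection (K.sampleSpan x) f]
  ring

/-- The representer theorem. -/
theorem IsKRR.mem_sampleSpan {n : ℕ} {q : X → ℝ} {x : Fin n → X} {y : Fin n → ℝ} {lam : ℝ}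
    (hlam : 0 ≤ lam) {f : K.NativeSpace} (hf : K.IsKRR q x y lam f) : f ∈ K.sampleSpan x := by
  have hle : ‖f - (K.sampleSpan x).starProjection f‖ ^ 2 ≤ 0 := by
    rw [IsKRR] at hf
    split_ifs at hf with h0
    · have h1 := hf.2 ((K.sampleSpan x).starProjection f)
        fun i => (K.starProjection_sampleSpan_apply x f i).trans (hf.1 i)
      have h2 := K.norm_sq_eq_add_starProjection (K.sampleSpan x) f
      have h3 := pow_le_pow_left₀ (norm_nonneg _) h1 2
      linarith
    · have h1 := hf ((K.sampleSpan x).starProjection f)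
      have h2 := K.risk_starProjection q x y lam f
      have h3 : 0 < lam := lt_of_le_of_ne hlam (Ne.symm h0)
      have h4 : lam * ‖f - (K.sampleSpan x).starProjection f‖ ^ 2 ≤ lam * 0 := by linarith
      exact le_of_mul_le_mul_left h4 h3
  have h0 : f - (K.sampleSpan x).starProjection f = 0 := by
    have := pow_eq_zero_iff (two_ne_zero) |>.mp (le_antisymm hle (sq_nonneg _))
    exact norm_eq_zero.mp this
  rw [sub_eq_zero.mp h0]
  exact Submodule.starProjection_apply_mem _ _

theorem continuous_risk {n : ℕ} (q : X → ℝ) (x : Fin n → X) (y : Fin n → ℝ) (lam : ℝ) :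
    Continuous (K.risk q x y lam) := by
  unfold risk
  have h : ∀ t : X, Continuous fun f : K.NativeSpace => f t := fun t => RKHS.continuous_eval t
  refine Continuous.add (continuous_const.mul (continuous_finsetSum _ fun i _ => ?_))
    (continuous_const.mul (continuous_norm.pow 2))
  exact continuous_const.mul (((h (x i)).sub continuous_const).pow 2)

theorem le_risk {n : ℕ} {q : X → ℝ} {x : Fin n → X} (hq : ∀ i, 0 < q (x i)) (y : Fin n → ℝ)
    (lam : ℝ) (f : K.NativeSpace) : lam * ‖f‖ ^ 2 ≤ K.risk q x y lam f := by
  rw [risk]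
  refine le_add_of_nonneg_left (mul_nonneg (by positivity) (Finset.sum_nonneg fun i _ => ?_))
  exact mul_nonneg (one_div_nonneg.mpr (hq i).le) (sq_nonneg _)

/-- The kernel ridge regression problem is solvable as soon as the data can be interpolated. -/
theorem exists_isKRR {n : ℕ} {q : X → ℝ} {x : Fin n → X} (hq : ∀ i, 0 < q (x i)) {y : Fin n → ℝ}
    {lam : ℝ} (hlam : 0 ≤ lam) {h : K.NativeSpace} (hh : ∀ i, h (x i) = y i) :
    ∃ f, K.IsKRR q x y lam f := by
  rcases hlam.eq_or_lt with rfl | hpos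
  · refine ⟨(K.sampleSpan x).starProjection h, ?_⟩
    rw [IsKRR, if_pos rfl]
    refine ⟨fun i => (K.starProjection_sampleSpan_apply x h i).trans (hh i), fun g hg => ?_⟩
    -- two interpolants differ by a vector orthogonal to the kernel sections
    have hproj : (K.sampleSpan x).starProjection h = (K.sampleSpan x).starProjection g := by
      rw [← sub_eq_zero, ← map_sub, Submodule.starProjection_apply_eq_zero_iff, sampleSpan,
        Submodule.mem_orthogonal]
      intro u hu
      induction hu using Submodule.span_induction with
      | mem u hu =>
        obtain ⟨i, rfl⟩ := hu
        rw [inner_sub_right, K.inner_kernelSection, K.inner_kernelSection, hh, hg, sub_self]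
      | zero => exact inner_zero_left _
      | add u v _ _ hu hv => rw [inner_add_left, hu, hv, add_zero]
      | smul c u _ hu => rw [real_inner_smul_left, hu, mul_zero]
    rw [hproj]
    exact Submodule.norm_starProjection_apply_le _ g
  · have hcont : Continuous fun f : K.sampleSpan x => K.risk q x y lam f :=
      (K.continuous_risk q x y lam).comp continuous_subtype_val
    have hprop : ProperSpace (K.sampleSpan x) := FiniteDimensional.proper ℝ _
    have hlim : Filter.Tendsto (fun f : K.sampleSpan x => K.risk q x y lam f)
        (Filter.cocompact _) Filter.atTop := by
      refine Filter.tendsto_atTop_mono (fun f => K.le_risk hq y lam f) ?_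
      have := (Filter.tendsto_pow_atTop (α := ℝ) two_ne_zero).comp
        (tendsto_norm_cocompact_atTop (E := K.sampleSpan x))
      exact this.const_mul_atTop hpos
    obtain ⟨f, hf⟩ := hcont.exists_forall_le hlim
    refine ⟨f, ?_⟩
    rw [IsKRR, if_neg hpos.ne']
    intro g
    refine (hf ⟨_, Submodule.starProjection_apply_mem (K.sampleSpan x) g⟩).trans ?_
    rw [← K.risk_starProjection q x y lam g]
    exact le_add_of_nonneg_right (by positivity)

theorem krr_mem_sampleSpan {n : ℕ} {q : X → ℝ} {x : Fin n → X} (hq : ∀ i, 0 < q (x i))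
    {y : Fin n → ℝ} {lam : ℝ} (hlam : 0 ≤ lam) {h : K.NativeSpace} (hh : ∀ i, h (x i) = y i) :
    K.krr q x y lam ∈ K.sampleSpan x :=
  IsKRR.mem_sampleSpan K hlam (Classical.epsilon_spec (K.exists_isKRR hq hlam hh))

/-- Kernel ridge regression returns zero on zero data. -/
theorem krr_zero {n : ℕ} {q : X → ℝ} {x : Fin n → X} (hq : ∀ i, 0 < q (x i)) {lam : ℝ}
    (hlam : 0 ≤ lam) : K.krr q x (fun _ => 0) lam = 0 := by
  have h0 : ∀ i, (0 : K.NativeSpace) (x i) = 0 := fun i => by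
    rw [← K.inner_kernelSection, inner_zero_right]
  have hspec : K.IsKRR q x (fun _ => 0) lam (K.krr q x (fun _ => 0) lam) :=
    Classical.epsilon_spec (K.exists_isKRR hq hlam h0)
  set f := K.krr q x (fun _ => 0) lam
  rw [IsKRR] at hspec
  rw [← norm_le_zero_iff]
  split_ifs at hspec with hl
  · simpa using hspec.2 0 h0
  · have h1 := (K.le_risk hq _ lam f).trans (hspec 0)
    have h2 : K.risk q x (fun _ => 0) lam 0 = 0 := by simp [risk, h0]
    have hpos : 0 < lam := lt_of_le_of_ne hlam (Ne.symm hl)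
    rw [h2] at h1
    have h3 : ‖f‖ ^ 2 ≤ 0 := by nlinarith [sq_nonneg ‖f‖]
    exact (pow_eq_zero_iff two_ne_zero |>.mp (le_antisymm h3 (sq_nonneg _))).le

end Regression

section Interpolation
variable {X : Type*} [TopologicalSpace X] [CompactSpace X] [SecondCountableTopology X]
  [MeasurableSpace X] [BorelSpace X] (K : PSDKernel X) (ρ : Measure X) [IsFiniteMeasure ρ]

theorem continuous_kernel_right (x : X) : Continuous fun t => K.toFun x t :=
  K.continuous_toFun.comp (by fun_prop : Continuous fun t : X => (x, t))

/-- The values `∫ K(xᵢ, ·) dρ` can be interpolated in the native space: they are the values of the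
Riesz representative of `f ↦ ∫ f dρ` on the span of the kernel sections. -/
theorem exists_interpolant_integral {n : ℕ} (x : Fin n → X) :
    ∃ h : K.NativeSpace, ∀ i, h (x i) = ∫ t, K.toFun (x i) t ∂ρ := by
  have hint : ∀ f : K.sampleSpan x, Integrable (fun t => (f : K.NativeSpace) t) ρ := by
    intro f
    obtain ⟨a, ha⟩ := K.exists_apply_eq_of_mem_sampleSpan f.2
    simp_rw [ha]
    refine integrable_finsetSum _ fun i _ => Integrable.const_mul ?_ _
    exact (K.continuous_kernel_right (x i)).integrable_of_hasCompactSupport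
      (HasCompactSupport.of_compactSpace _)
  let Φ : K.sampleSpan x →ₗ[ℝ] ℝ :=
    { toFun := fun f => ∫ t, (f : K.NativeSpace) t ∂ρ
      map_add' := fun f g => by
        rw [← integral_add (hint f) (hint g)]
        refine integral_congr_ae (Filter.Eventually.of_forall fun t => ?_)
        simp only [← K.inner_kernelSection, Submodule.coe_add, inner_add_right]
      map_smul' := fun c f => by
        rw [RingHom.id_apply, smul_eq_mul, ← integral_const_mul]
        refine integral_congr_ae (Filter.Eventually.of_forall fun t => ?_)
        simp only [← K.inner_kernelSection, Submodule.coe_smul, real_inner_smul_right] }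
  refine ⟨((InnerProductSpace.toDual ℝ (K.sampleSpan x)).symm Φ.toContinuousLinearMap :
    K.sampleSpan x), fun i => ?_⟩
  have hi : K.kernelSection (x i) ∈ K.sampleSpan x := Submodule.subset_span ⟨i, rfl⟩
  have := InnerProductSpace.toDual_symm_apply (𝕜 := ℝ) (x := (⟨_, hi⟩ : K.sampleSpan x))
    (y := Φ.toContinuousLinearMap)
  rw [Submodule.coe_inner] at this
  rw [← K.inner_kernelSection, real_inner_comm, this]
  change ∫ t, K.kernelSection (x i) t ∂ρ = _
  simp_rw [K.kernelSection_apply, fun t => K.symm t (x i)]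

end Interpolation
end PSDKernel

/-! ### Lower bounds from targets and test functions -/

namespace PSDKernel
section LowerBounds
variable {X : Type*} [TopologicalSpace X] [CompactSpace X] [SecondCountableTopology X]
  [MeasurableSpace X] [BorelSpace X] (K : PSDKernel X) (ρ : Measure X) [IsFiniteMeasure ρ]

theorem hsNormSq_coe (s : ℝ) (f : C(X, ℝ)) :
    K.hsNormSq ρ s f = K.hsNormSqLp ρ s (ContinuousMap.toLp 2 ρ ℝ f) := by
  classical
  have h : MemLp f 2 ρ := (memLp_congr_ae (coe_toLp_ae ρ f)).mp (Lp.memLp _)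
  rw [hsNormSq, dif_pos h]
  exact congrArg _ (Lp.ext (h.coeFn_toLp.trans (coe_toLp_ae ρ f).symm))

theorem eigenvalue_nonneg (j : ℕ) : 0 ≤ K.eigenvalue ρ j :=
  Real.sSup_nonneg fun _ ht => ht.1.le

theorem exists_lt_rank_of_lt_eigenvalue {j : ℕ} {μ : ℝ} (hμ : 0 ≤ μ) (h : μ < K.eigenvalue ρ j) :
    ∃ t, μ < t ∧ (j : Cardinal) ≤ Module.rank ℝ (K.spectralSpan ρ t) := by
  have hne : {t : ℝ | 0 < t ∧ (j : Cardinal) ≤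
      Module.rank ℝ ↥(⨆ ν ∈ Set.Ici t, K.eigenspace ρ ν)}.Nonempty := by
    by_contra hne
    rw [Set.not_nonempty_iff_eq_empty] at hne
    rw [eigenvalue, hne, Real.sSup_empty] at h
    exact absurd h hμ.not_gt
  obtain ⟨t, ht, hlt⟩ := exists_lt_of_lt_csSup hne h
  exact ⟨t, hlt, ht.2⟩

theorem integralOp_sum_eigenvectors (T : Finset ℝ) (c : ℝ → ℝ) (F : ℝ → Lp ℝ 2 ρ)
    (hF : ∀ ν, F ν ∈ K.eigenspace ρ ν) :
    K.integralOp ρ (∑ ν ∈ T, c ν • F ν) = ∑ ν ∈ T, (ν * c ν) • F ν := by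
  rw [map_sum]
  refine Finset.sum_congr rfl fun ν _ => ?_
  rw [map_smul, (K.mem_eigenspace ρ).mp (hF ν), smul_smul, mul_comm]

/-- Evaluation of potentials at the sample points. -/
def samplePotential {n : ℕ} (x : Fin n → X) : Lp ℝ 2 ρ →ₗ[ℝ] (Fin n → ℝ) where
  toFun f i := K.potential ρ f (x i)
  map_add' f g := by
    ext i
    change ∫ y, K.toFun (x i) y * (f + g) y ∂ρ
      = ∫ y, K.toFun (x i) y * f y ∂ρ + ∫ y, K.toFun (x i) y * g y ∂ρ
    rw [← integral_add (K.integrable_mul ρ f _) (K.integrable_mul ρ g _)]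
    refine integral_congr_ae ?_
    filter_upwards [Lp.coeFn_add f g] with y hy
    rw [hy, Pi.add_apply, mul_add]
  map_smul' c f := by
    ext i
    change ∫ y, K.toFun (x i) y * (c • f) y ∂ρ = c * ∫ y, K.toFun (x i) y * f y ∂ρ
    rw [← integral_const_mul]
    refine integral_congr_ae ?_
    filter_upwards [Lp.coeFn_smul c f] with y hy
    rw [hy, Pi.smul_apply, smul_eq_mul, mul_left_comm]

/-- If the operator has more than `n` positive eigenvalues, some nonzero finite combination of
eigenfunctions vanishes at all sample points. Its multiples are smooth targets on which kernel
ridge regression returns zero, so that the error over all of `ℋ^s` is infinite. -/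
theorem supErrorSq_eq_top {n : ℕ} {q : X → ℝ} {x : Fin n → X} (hq : ∀ i, 0 < q (x i)) {lam : ℝ}
    (hlam : 0 ≤ lam) (s p : ℝ) {j : ℕ} (hj : n < j) (hpos : 0 < K.eigenvalue ρ j) :
    K.supErrorSq ρ q x lam s p = ⊤ := by
  obtain ⟨t, ht, hrank⟩ := K.exists_lt_rank_of_lt_eigenvalue ρ le_rfl hpos
  have hker : ∃ h ∈ K.spectralSpan ρ t, h ≠ 0 ∧ ∀ i, K.potential ρ h (x i) = 0 := by
    by_contra! hcon
    have hinj : Function.Injective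
        ((K.samplePotential ρ x).comp (K.spectralSpan ρ t).subtype) := by
      rw [injective_iff_map_eq_zero]
      intro h h0
      by_contra hne
      obtain ⟨i, hi⟩ := hcon h h.2 (fun h' => hne (Subtype.ext h'))
      exact hi (congrFun h0 i)
    have h1 := LinearMap.lift_rank_le_of_injective _ hinj
    rw [rank_fin_fun, Cardinal.lift_natCast, Cardinal.lift_uzero] at h1
    have h2 := hrank.trans h1
    exact absurd (Nat.cast_le.mp h2) hj.not_ge
  obtain ⟨h, hmem, hne, hzero⟩ := hker
  obtain ⟨T, F, hT, hF, rfl⟩ := K.exists_eigen_decomposition ρ hmem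
  obtain ⟨ν, hν, hFν⟩ : ∃ ν ∈ T, F ν ≠ 0 := by
    by_contra! hcon
    exact hne (Finset.sum_eq_zero hcon)
  have hν0 : 0 < ν := ht.trans_le (hT ν hν)
  set h := ∑ ν ∈ T, F ν with hh
  set f := K.potential ρ h with hf
  have hLh : ContinuousMap.toLp 2 ρ ℝ f = ∑ ν ∈ T, ν • F ν := by
    have := K.integralOp_sum_eigenvectors ρ T (fun _ => 1) F hF
    simpa [← integralOp_eq_toLp_potential, hf, hh] using this
  have hfmem : ContinuousMap.toLp 2 ρ ℝ f ∈ K.spectralSpan ρ t := by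
    rw [hLh]
    exact Submodule.sum_mem _ fun ν hν => Submodule.smul_mem _ _
      (K.eigenspace_le_spectralSpan ρ (hT ν hν) (hF ν))
  have hproj : (K.eigenspace ρ ν).topologicalClosure.starProjection
      (ContinuousMap.toLp 2 ρ ℝ f) = ν • F ν := by
    rw [hLh, map_sum, Finset.sum_eq_single_of_mem ν hν, map_smul,
      K.starProjection_eigenspace_of_mem ρ (hF ν)]
    intro ν' _ hne'
    rw [map_smul, K.starProjection_eigenspace_of_ne ρ hne' (hF ν'), smul_zero]
  set a : ℝ := ν ^ (-p) * ‖ν • F ν‖ ^ 2 with ha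
  have ha0 : 0 < a := by
    have : 0 < ‖ν • F ν‖ := norm_pos_iff.mpr (smul_ne_zero hν0.ne' hFν)
    positivity
  have herr : ∀ c : ℝ, ENNReal.ofReal (c ^ 2 * a) ≤ K.errorSq ρ q x lam p (c • f) := by
    intro c
    have hy : (fun i => (c • f) (x i)) = fun _ => (0 : ℝ) := by
      funext i
      rw [ContinuousMap.smul_apply, hzero i, smul_zero]
    have hfun : (fun t => K.krr q x (fun i => (c • f) (x i)) lam t - (c • f) t)
        = ((-c) • f : C(X, ℝ)) := by
      funext t
      rw [hy, K.krr_zero hq hlam, ← K.inner_kernelSection, inner_zero_right]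
      simp
    rw [errorSq, hfun, hsNormSq_coe, map_smul]
    refine le_trans (le_of_eq ?_) (K.le_hsNormSqLp ρ p _ {ν} (by simpa using hν0))
    rw [Finset.sum_singleton, map_smul, hproj, ← ofReal_norm, ← ENNReal.ofReal_pow (norm_nonneg _),
      ← ENNReal.ofReal_mul (by positivity), norm_smul (-c), mul_pow, Real.norm_eq_abs, sq_abs]
    congr 1
    rw [ha]; ring
  refine ENNReal.eq_top_of_forall_nnreal_le fun r => ?_
  have hlt : K.hsNormSq ρ s (Real.sqrt (r / a) • f : C(X, ℝ)) < ⊤ := by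
    rw [hsNormSq_coe, map_smul]
    exact K.hsNormSqLp_lt_top ρ ht s (Submodule.smul_mem _ _ hfmem)
  refine le_trans ?_ (le_iSup (fun f : {f : C(X, ℝ) // K.hsNormSq ρ s f < ⊤} =>
    K.errorSq ρ q x lam p f.1) ⟨_, hlt⟩)
  refine le_trans (le_of_eq ?_) (herr _)
  rw [Real.sq_sqrt (by positivity), div_mul_cancel₀ _ ha0.ne', ENNReal.ofReal_coe_nnreal]

theorem le_supErrorSq {n : ℕ} {q : X → ℝ} {x : Fin n → X} (hq : ∀ i, 0 < q (x i)) {lam : ℝ}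
    (hlam : 0 ≤ lam) (s : ℝ) {p : ℝ} {j : ℕ} (hj : n < j)
    (h2 : p = 2 → 0 < K.eigenvalue ρ j) :
    ENNReal.ofReal (1 / 2 * K.eigenvalue ρ j ^ (2 - p)) ≤ K.supErrorSq ρ q x lam s p := by
  rcases (K.eigenvalue_nonneg ρ j).eq_or_lt with h0 | hpos
  · have hp : 2 - p ≠ 0 := fun h => (h2 (by linarith)).ne h0
    rw [← h0, Real.zero_rpow hp]
    simp
  · rw [K.supErrorSq_eq_top ρ hq hlam s p hj hpos]
    exact le_top

/-- The lower bound on a ball: the target is the constant function `L 1 = lam₀`. The error is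
`L(∑ᵢ aᵢ δ_{xᵢ} - ρ)` for some coefficients `aᵢ`, and is tested against a function `g` that
vanishes at the sample points but has a large integral. -/
theorem le_ballErrorSq_of_test [IsProbabilityMeasure ρ] [ρ.IsOpenPosMeasure] {n : ℕ} {q : X → ℝ}
    {x : Fin n → X} (hq : ∀ i, 0 < q (x i)) {lam : ℝ} (hlam : 0 ≤ lam) (s : ℝ) {p : ℝ} (hp : p ≤ 2)
    {lam₀ μ : ℝ} (h₀ : 0 < lam₀) (hμ : 0 < μ) (hone : ∀ x, ∫ y, K.toFun x y ∂ρ = lam₀)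
    (g : C(X, ℝ)) (hgx : ∀ i, g (x i) = 0)
    (hgmem : ContinuousMap.toLp 2 ρ ℝ g ∈ K.spectralSpan ρ μ)
    (hgpos : 0 < ∫ y, g y * g y ∂ρ) (hg : ∫ y, g y * g y ∂ρ ≤ 2 * (∫ y, g y ∂ρ) ^ 2) :
    ENNReal.ofReal (1 / 2 * μ ^ (2 - p)) ≤ K.ballErrorSq ρ q x lam s p (lam₀ ^ (2 - s)) := by
  set one : C(X, ℝ) := 1 with hone'
  have hL1 : K.potential ρ (ContinuousMap.toLp 2 ρ ℝ one) = lam₀ • one := by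
    ext x
    rw [K.potential_toLp_apply]
    simp [hone', hone]
  have hmem1 : ContinuousMap.toLp 2 ρ ℝ one ∈ K.eigenspace ρ lam₀ := by
    rw [K.mem_eigenspace, integralOp_eq_toLp_potential, hL1, map_smul]
  have hnorm1 : ‖ContinuousMap.toLp 2 ρ ℝ one‖ ^ 2 = 1 := by
    rw [← real_inner_self_eq_norm_sq, inner_toLp_toLp]
    simp [hone']
  have hball : K.hsNormSq ρ s (lam₀ • one : C(X, ℝ)) ≤ ENNReal.ofReal (lam₀ ^ (2 - s)) := by
    rw [hsNormSq_coe, map_smul,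
      K.hsNormSqLp_of_mem_eigenspace ρ h₀ s (Submodule.smul_mem _ _ hmem1), norm_smul, mul_pow,
      hnorm1, mul_one, Real.norm_eq_abs, sq_abs, sub_eq_add_neg, add_comm 2, Real.rpow_add h₀,
      Real.rpow_two]
  refine le_trans ?_ (le_iSup (fun f : {f : C(X, ℝ) //
    K.hsNormSq ρ s f ≤ ENNReal.ofReal (lam₀ ^ (2 - s))} => K.errorSq ρ q x lam p f.1) ⟨_, hball⟩)
  obtain ⟨h', hh'⟩ := K.exists_interpolant_integral ρ x
  have hinterp : ∀ i, h' (x i) = (lam₀ • one : C(X, ℝ)) (x i) := fun i => by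
    rw [hh', hone]; simp [hone']
  obtain ⟨a, ha⟩ := K.exists_apply_eq_of_mem_sampleSpan (K.krr_mem_sampleSpan hq hlam hinterp)
  set sec : Fin n → C(X, ℝ) := fun i => ⟨fun t => K.toFun (x i) t, K.continuous_kernel_right (x i)⟩
    with hsec
  set u : C(X, ℝ) := ∑ i, a i • sec i - lam₀ • one with hu
  have hfun : (fun t => K.krr q x (fun i => (lam₀ • one : C(X, ℝ)) (x i)) lam t
      - (lam₀ • one : C(X, ℝ)) t) = u := by
    funext t
    rw [ha, hu, ContinuousMap.sub_apply, ContinuousMap.sum_apply]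
    rfl
  change _ ≤ K.hsNormSq ρ p _
  rw [hfun, hsNormSq_coe]
  obtain ⟨T, F, hT, hF, hgF⟩ := K.exists_eigen_decomposition ρ hgmem
  set h : Lp ℝ 2 ρ := ∑ ν ∈ T, ν⁻¹ • F ν with hh
  have hLh : K.integralOp ρ h = ContinuousMap.toLp 2 ρ ℝ g := by
    rw [hh, K.integralOp_sum_eigenvectors ρ T _ F hF, hgF]
    refine Finset.sum_congr rfl fun ν hν => ?_
    rw [mul_inv_cancel₀ (hμ.trans_le (hT ν hν)).ne', one_smul]
  have hpot : K.potential ρ h = g := by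
    apply ContinuousMap.toLp_injective ρ (p := 2) (𝕜 := ℝ)
    rw [← hLh]; rfl
  have hpair : ∑ ν ∈ T, ν⁻¹ * ⟪ContinuousMap.toLp 2 ρ ℝ u, F ν⟫ = -∫ y, g y ∂ρ := by
    have e1 : ∑ ν ∈ T, ν⁻¹ * ⟪ContinuousMap.toLp 2 ρ ℝ u, F ν⟫ =
        ⟪ContinuousMap.toLp 2 ρ ℝ u, h⟫ := by
      rw [hh, inner_sum]
      exact Finset.sum_congr rfl fun ν _ => (real_inner_smul_right _ _ _).symm
    have e2 : ∀ i, ⟪ContinuousMap.toLp 2 ρ ℝ (sec i), h⟫ = 0 := fun i => by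
      rw [inner_toLp_left, ← hgx i, ← hpot]; rfl
    have e3 : ⟪lam₀ • ContinuousMap.toLp 2 ρ ℝ one, h⟫ = ∫ y, g y ∂ρ := by
      rw [← (K.mem_eigenspace ρ).mp hmem1, K.integralOp_symm, hLh, inner_toLp_toLp]
      simp [hone']
    rw [e1, hu, map_sub, map_sum, map_smul, inner_sub_left, e3, sum_inner, Finset.sum_eq_zero,
      zero_sub]
    intro i _
    rw [map_smul, real_inner_smul_left, e2, mul_zero]
  have hnorm : ∑ ν ∈ T, ‖F ν‖ ^ 2 ≤ ∫ y, g y * g y ∂ρ := by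
    rw [← K.norm_sq_sum_eigenvectors ρ T F hF, ← hgF, ← real_inner_self_eq_norm_sq,
      inner_toLp_toLp]
  refine le_trans (ENNReal.ofReal_le_ofReal ?_)
    (K.ofReal_le_hsNormSqLp ρ hμ hp hgpos _ T hT F hF hnorm)
  rw [hpair]
  refine mul_le_mul_of_nonneg_right ?_ (Real.rpow_nonneg hμ.le _)
  rw [le_div_iff₀ hgpos, neg_sq]
  linarith

end LowerBounds
end PSDKernel

section FiniteDimensional
variable {X : Type*} [TopologicalSpace X] [CompactSpace X] [SecondCountableTopology X]
  [MeasurableSpace X] [BorelSpace X] (ρ : Measure X) [IsFiniteMeasure ρ] [ρ.IsOpenPosMeasure]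

/-- A finite-dimensional space of continuous functions has a basis that is orthonormal in
`L²(ρ)`. -/
theorem exists_orthonormal_continuousMap (W : Submodule ℝ C(X, ℝ)) [FiniteDimensional ℝ W] :
    ∃ b : Fin (Module.finrank ℝ W) → C(X, ℝ), (∀ l, b l ∈ W) ∧
      (∀ k l, ∫ y, b k y * b l y ∂ρ = if k = l then 1 else 0) ∧
      ∀ f ∈ W, f = ∑ l, (∫ y, b l y * f y ∂ρ) • b l := by
  have hinj : Function.Injective (ContinuousMap.toLp 2 ρ ℝ : C(X, ℝ) →L[ℝ] Lp ℝ 2 ρ) :=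
    ContinuousMap.toLp_injective ρ
  set W' := W.map (ContinuousMap.toLp 2 ρ ℝ : C(X, ℝ) →L[ℝ] Lp ℝ 2 ρ).toLinearMap with hW'
  have hfin : Module.finrank ℝ W' = Module.finrank ℝ W :=
    (Submodule.equivMapOfInjective _ hinj W).finrank_eq.symm
  let e := (stdOrthonormalBasis ℝ W').reindex (finCongr hfin)
  have hex : ∀ l, ∃ f ∈ W, ContinuousMap.toLp 2 ρ ℝ f = (e l : Lp ℝ 2 ρ) := fun l => (e l).2
  choose b hbW hb using hex
  refine ⟨b, hbW, fun k l => ?_, fun f hf => ?_⟩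
  · rw [← inner_toLp_toLp, hb, hb, ← Submodule.coe_inner]
    exact orthonormal_iff_ite.mp e.orthonormal k l
  · apply hinj
    have := e.sum_repr' ⟨ContinuousMap.toLp 2 ρ ℝ f, f, hf, rfl⟩
    have h2 := congrArg (Subtype.val) this
    rw [AddSubmonoidClass.coe_finsetSum] at h2
    refine h2.symm.trans ?_
    rw [map_sum]
    refine Finset.sum_congr rfl fun l _ => ?_
    rw [map_smul, hb, Submodule.coe_smul, Submodule.coe_inner, ← hb, inner_toLp_toLp]

end FiniteDimensional

/-! ### Test functions and the spectrum of a filtered kernel -/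

section TestFunction
variable {X : Type*} [TopologicalSpace X] [CompactSpace X] [SecondCountableTopology X]
  [MeasurableSpace X] [BorelSpace X] (ρ : Measure X) [IsFiniteMeasure ρ] [ρ.IsOpenPosMeasure]

theorem integrable_continuousMap (f : C(X, ℝ)) : Integrable f ρ :=
  f.continuous.integrable_of_hasCompactSupport (HasCompactSupport.of_compactSpace _)

theorem integral_sum_smul_mul_sum_smul {ι : Type*} [Fintype ι] [DecidableEq ι] {b : ι → C(X, ℝ)}
    (hb : ∀ k l, ∫ y, b k y * b l y ∂ρ = if k = l then 1 else 0) (c c' : ι → ℝ) :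
    ∫ y, (∑ l, c l • b l) y * (∑ l, c' l • b l) y ∂ρ = ∑ l, c l * c' l := by
  have h1 : ∀ k l, ⟪ContinuousMap.toLp 2 ρ ℝ (b k), ContinuousMap.toLp 2 ρ ℝ (b l)⟫
      = if k = l then (1 : ℝ) else 0 := fun k l => (inner_toLp_toLp ρ _ _).trans (hb k l)
  have := inner_toLp_toLp ρ (∑ l, c l • b l) (∑ l, c' l • b l)
  rw [← this]
  simp only [map_sum, map_smul, sum_inner, inner_sum, real_inner_smul_left,
    real_inner_smul_right, h1]
  simp [mul_comm]

/-- The diagonal of the reproducing kernel of a finite-dimensional space dominates point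
evaluations. -/
theorem sq_apply_le_sum_sq {ι : Type*} [Fintype ι] [DecidableEq ι] {b : ι → C(X, ℝ)}
    (hb : ∀ k l, ∫ y, b k y * b l y ∂ρ = if k = l then 1 else 0) (c : ι → ℝ) (x : X) :
    (∑ l, c l • b l) x ^ 2 ≤
      (∑ l, b l x ^ 2) * ∫ y, (∑ l, c l • b l) y * (∑ l, c l • b l) y ∂ρ := by
  rw [integral_sum_smul_mul_sum_smul ρ hb]
  have h1 : (∑ l, c l • b l) x = ∑ l, c l * b l x := by simp [ContinuousMap.sum_apply]
  rw [h1, mul_comm]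
  refine (Finset.sum_mul_sq_le_sq_mul_sq _ _ _).trans_eq ?_
  congr 1
  exact Finset.sum_congr rfl fun l _ => pow_two _

/-- If a finite-dimensional space of continuous functions is invariant under a transitive family of
measure-preserving maps, the diagonal of its reproducing kernel is constant, hence equal to the
dimension. This bounds the values of its elements by their `L²` norm. -/
theorem sq_apply_le_finrank_mul_integral [IsProbabilityMeasure ρ] (V : Submodule ℝ C(X, ℝ))
    [FiniteDimensional ℝ V]
    (hV : ∀ x y, ∃ φ : C(X, X), φ x = y ∧ MeasurePreserving φ ρ ρ ∧ ∀ f ∈ V, f.comp φ ∈ V)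
    {f : C(X, ℝ)} (hf : f ∈ V) (x : X) :
    f x ^ 2 ≤ Module.finrank ℝ V * ∫ y, f y * f y ∂ρ := by
  obtain ⟨b, hbV, hb, hrep⟩ := exists_orthonormal_continuousMap ρ V
  set D : X → ℝ := fun x => ∑ l, b l x ^ 2 with hD
  have hbound : ∀ f ∈ V, ∀ x, f x ^ 2 ≤ D x * ∫ y, f y * f y ∂ρ := by
    intro f hf x
    have := sq_apply_le_sum_sq ρ hb (fun l => ∫ y, b l y * f y ∂ρ) x
    rwa [← hrep f hf] at this
  have hD0 : ∀ x, 0 ≤ D x := fun x => Finset.sum_nonneg fun l _ => sq_nonneg _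
  have hle : ∀ x y, D y ≤ D x := by
    intro x y
    obtain ⟨φ, hφ, hmp, hφV⟩ := hV x y
    -- the reproducing kernel at `y` is the extremal function for evaluation at `y`
    set k : C(X, ℝ) := ∑ l, b l y • b l with hk
    have hkV : k ∈ V := Submodule.sum_mem _ fun l _ => Submodule.smul_mem _ _ (hbV l)
    have hky : k y = D y := by
      simp [hk, hD, ContinuousMap.sum_apply, pow_two]
    have hkk : ∫ z, k z * k z ∂ρ = D y := by
      rw [hk, integral_sum_smul_mul_sum_smul ρ hb]
      exact Finset.sum_congr rfl fun l _ => (pow_two _).symm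
    have hint : ∫ z, (k.comp φ) z * (k.comp φ) z ∂ρ = D y := by
      rw [← hkk]
      conv_rhs => rw [← hmp.map_eq]
      exact (integral_map φ.continuous.aemeasurable
        (k * k).continuous.aestronglyMeasurable).symm
    have := hbound _ (hφV k hkV) x
    rw [hint, ContinuousMap.comp_apply, hφ, hky] at this
    rcases (hD0 y).eq_or_lt with h0 | hpos
    · rw [← h0]; exact hD0 x
    · nlinarith
  have hDx : D x = Module.finrank ℝ V := by
    have h1 : ∫ y, D y ∂ρ = D x := by
      rw [show D = fun _ => D x from funext fun y => le_antisymm (hle x y) (hle y x)]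
      simp
    rw [← h1, hD, integral_finsetSum]
    · simp [pow_two, hb]
    · exact fun l _ => integrable_continuousMap ρ (b l ^ 2)
  rw [← hDx]
  exact hbound f hf x

/-- A function with large integral vanishing at `n` points: the diagonal of the reproducing kernel
of the space of all `f ∈ V` that vanish at these points, where `dim V ≥ 2 n`. -/
theorem exists_test_function {n : ℕ} (hn : 0 < n) (x : Fin n → X) (V : Submodule ℝ C(X, ℝ))
    [FiniteDimensional ℝ V] (hdim : 2 * n ≤ Module.finrank ℝ V)
    (hV : ∀ f ∈ V, ∀ x, f x ^ 2 ≤ Module.finrank ℝ V * ∫ y, f y * f y ∂ρ) :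
    ∃ (N : ℕ) (w : Fin N → C(X, ℝ)), (∀ l, w l ∈ V) ∧ (∀ i l, w l (x i) = 0) ∧
      0 < ∫ y, (∑ l, w l * w l) y * (∑ l, w l * w l) y ∂ρ ∧
      ∫ y, (∑ l, w l * w l) y * (∑ l, w l * w l) y ∂ρ ≤ 2 * (∫ y, (∑ l, w l * w l) y ∂ρ) ^ 2 := by
  classical
  let ev : V →ₗ[ℝ] (Fin n → ℝ) :=
    { toFun := fun f i => (f : C(X, ℝ)) (x i)
      map_add' := fun f g => rfl
      map_smul' := fun c f => rfl }
  set W : Submodule ℝ C(X, ℝ) := (LinearMap.ker ev).map V.subtype with hW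
  have hWV : W ≤ V := by
    rintro _ ⟨f, -, rfl⟩; exact f.2
  have hWx : ∀ f ∈ W, ∀ i, f (x i) = 0 := by
    rintro _ ⟨f, hf, rfl⟩ i; exact congrFun hf i
  have hfin : Module.finrank ℝ W = Module.finrank ℝ (LinearMap.ker ev) :=
    (Submodule.equivMapOfInjective _ V.injective_subtype _).finrank_eq.symm
  have hfinW : FiniteDimensional ℝ W := Submodule.finiteDimensional_of_le hWV
  have hcard : Module.finrank ℝ V ≤ n + Module.finrank ℝ W := by
    rw [hfin, ← LinearMap.finrank_range_add_finrank_ker ev]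
    gcongr
    exact (Submodule.finrank_le _).trans_eq (by simp)
  set M := Module.finrank ℝ W with hM
  set N := Module.finrank ℝ V with hN
  obtain ⟨w, hwW, hw, -⟩ := exists_orthonormal_continuousMap ρ W
  refine ⟨_, w, fun l => hWV (hwW l), fun i l => hWx _ (hwW l) i, ?_⟩
  set g : C(X, ℝ) := ∑ l, w l * w l with hg
  have hgx : ∀ y, g y = ∑ l, w l y ^ 2 := fun y => by
    simp [hg, ContinuousMap.sum_apply, pow_two]
  have hg0 : ∀ y, 0 ≤ g y := fun y => by
    rw [hgx]; exact Finset.sum_nonneg fun l _ => sq_nonneg _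
  have hgN : ∀ y, g y ≤ N := by
    intro y
    have h1 : (∑ l, w l y • w l) ∈ V :=
      Submodule.sum_mem _ fun l _ => Submodule.smul_mem _ _ (hWV (hwW l))
    have h2 := hV _ h1 y
    rw [integral_sum_smul_mul_sum_smul ρ hw] at h2
    have h3 : (∑ l, w l y • w l) y = g y := by
      rw [hgx]; simp [ContinuousMap.sum_apply, pow_two]
    have h4 : ∑ l, w l y * w l y = g y := by simp [hgx, pow_two]
    rw [h3, h4] at h2
    rcases (hg0 y).eq_or_lt with h0 | hpos
    · rw [← h0]; positivity
    · nlinarith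
  have hgM : ∫ y, g y ∂ρ = M := by
    simp_rw [hgx]
    rw [integral_finsetSum]
    · simp only [pow_two, hw, if_true, Finset.sum_const, Finset.card_univ, Fintype.card_fin,
        nsmul_eq_mul, mul_one, hM]
    · exact fun l _ => integrable_continuousMap ρ (w l ^ 2)
  have hM0 : (0 : ℝ) < M := by
    have : 0 < M := by omega
    exact_mod_cast this
  have hcont : Continuous fun y => g y * g y := g.continuous.mul g.continuous
  constructor
  · rw [integral_pos_iff_support_of_nonneg (fun y => mul_self_nonneg _)
      (integrable_continuousMap ρ (g * g))]
    refine (isOpen_ne_fun hcont continuous_const).measure_pos ρ ?_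
    by_contra hne
    have hz : ∀ y, g y = 0 := by
      intro y
      by_contra hy
      exact hne ⟨y, mul_self_ne_zero.mpr hy⟩
    simp_rw [hz, integral_zero] at hgM
    exact hM0.ne hgM
  · have h1 : ∫ y, g y * g y ∂ρ ≤ ∫ y, (N : ℝ) * g y ∂ρ :=
      integral_mono (integrable_continuousMap ρ (g * g))
        ((integrable_continuousMap ρ g).const_mul _)
        fun y => mul_le_mul_of_nonneg_right (hgN y) (hg0 y)
    rw [integral_const_mul, hgM] at h1
    rw [hgM]
    have h2 : (N : ℝ) ≤ 2 * M := by
      have : N ≤ 2 * M := by omega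
      exact_mod_cast this
    nlinarith

end TestFunction

section Density
variable {X : Type*} [TopologicalSpace X] [CompactSpace X] [SecondCountableTopology X] [T2Space X]
  [MeasurableSpace X] [BorelSpace X] (ρ : Measure X) [IsFiniteMeasure ρ]

/-- By the Stone–Weierstrass theorem, a multiplicative filtration that separates points is total in
`L²(ρ)`. -/
theorem eq_zero_of_inner_eq_zero_of_separates {H : ℕ → Submodule ℝ C(X, ℝ)}
    (hone : (1 : C(X, ℝ)) ∈ H 0)
    (hmul : ∀ m, ∀ f ∈ (Finset.range (m + 1)).sup H, ∀ g ∈ (Finset.range (m + 1)).sup H,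
      f * g ∈ (Finset.range (2 * m + 1)).sup H)
    (hsep : ∀ x y, x ≠ y → ∃ k, ∃ Y ∈ H k, Y x ≠ Y y) (f : Lp ℝ 2 ρ)
    (hf : ∀ k, ∀ Y ∈ H k, ⟪ContinuousMap.toLp 2 ρ ℝ Y, f⟫ = 0) : f = 0 := by
  have hmono : ∀ {m m' : ℕ}, m ≤ m' →
      (Finset.range (m + 1)).sup H ≤ (Finset.range (m' + 1)).sup H := fun h =>
    Finset.sup_mono (Finset.range_mono (by omega))
  have hle : ∀ {k m : ℕ}, k ≤ m → H k ≤ (Finset.range (m + 1)).sup H := fun h =>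
    Finset.le_sup (f := H) (Finset.mem_range.mpr (by omega))
  let S : Subalgebra ℝ C(X, ℝ) :=
    { carrier := {f | ∃ m, f ∈ (Finset.range (m + 1)).sup H}
      mul_mem' := by
        rintro f g ⟨m, hf⟩ ⟨m', hg⟩
        exact ⟨_, hmul (max m m') f (hmono (le_max_left _ _) hf) g (hmono (le_max_right _ _) hg)⟩
      add_mem' := by
        rintro f g ⟨m, hf⟩ ⟨m', hg⟩
        exact ⟨max m m', Submodule.add_mem _ (hmono (le_max_left _ _) hf)
          (hmono (le_max_right _ _) hg)⟩
      algebraMap_mem' := fun r => ⟨0, by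
        rw [Algebra.algebraMap_eq_smul_one]
        exact Submodule.smul_mem _ _ (hle le_rfl hone)⟩ }
  have hS : S.topologicalClosure = ⊤ := by
    refine ContinuousMap.subalgebra_topologicalClosure_eq_top_of_separatesPoints S ?_
    intro x y hxy
    obtain ⟨k, Y, hY, hne⟩ := hsep x y hxy
    exact ⟨Y, ⟨Y, ⟨k, hle le_rfl hY⟩, rfl⟩, hne⟩
  have hSf : ∀ g ∈ S, ⟪ContinuousMap.toLp 2 ρ ℝ g, f⟫ = 0 := by
    rintro g ⟨m, hg⟩
    have hsup : (Finset.range (m + 1)).sup H ≤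
        (LinearMap.ker (innerₛₗ ℝ f)).comap
          (ContinuousMap.toLp 2 ρ ℝ : C(X, ℝ) →L[ℝ] Lp ℝ 2 ρ).toLinearMap := by
      refine Finset.sup_le fun k _ Y hY => ?_
      have := hf k Y hY
      rw [real_inner_comm] at this
      exact this
    rw [real_inner_comm]
    exact hsup hg
  have hall : ∀ g : C(X, ℝ), ⟪ContinuousMap.toLp 2 ρ ℝ g, f⟫ = 0 := by
    intro g
    have hg : g ∈ S.topologicalClosure := hS ▸ Algebra.mem_top
    have hclosed : IsClosed {g : C(X, ℝ) | ⟪ContinuousMap.toLp 2 ρ ℝ g, f⟫ = 0} :=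
      isClosed_eq ((ContinuousLinearMap.continuous _).inner continuous_const) continuous_const
    exact closure_minimal (s := (S : Set C(X, ℝ))) hSf hclosed hg
  have hdense : DenseRange (ContinuousMap.toLp 2 ρ ℝ : C(X, ℝ) →L[ℝ] Lp ℝ 2 ρ) :=
    ContinuousMap.toLp_denseRange ℝ ρ ℝ (by norm_num)
  exact hdense.eq_zero_of_inner_right ℝ hall

end Density

namespace PSDKernel
section Spectrum
variable {X : Type*} [TopologicalSpace X] [CompactSpace X] [SecondCountableTopology X]
  [MeasurableSpace X] [BorelSpace X] (K : PSDKernel X) (ρ : Measure X) [IsFiniteMeasure ρ]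
  {H : ℕ → Submodule ℝ C(X, ℝ)} {ev : ℕ → ℝ}

theorem toLp_mem_eigenspace {c : ℝ} {Y : C(X, ℝ)}
    (hY : ∀ x, ∫ y, K.toFun x y * Y y ∂ρ = c * Y x) :
    ContinuousMap.toLp 2 ρ ℝ Y ∈ K.eigenspace ρ c := by
  rw [mem_eigenspace, integralOp_eq_toLp_potential, ← map_smul]
  congr 1
  ext x
  rw [K.potential_toLp_apply, hY]
  rfl

/-- With a complete system of eigenspaces `H k` with antitone eigenvalues `ev k`, there are at most
`dim (H 0 + … + H M)` eigenvalues greater than `ev (M + 1)`. -/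
theorem eigenvalue_le_of_finrank_lt [∀ k, FiniteDimensional ℝ (H k)]
    (hev : ∀ k, ∀ Y ∈ H k, ∀ x, ∫ y, K.toFun x y * Y y ∂ρ = ev k * Y x) (hanti : Antitone ev)
    (hdense : ∀ f : Lp ℝ 2 ρ, (∀ k, ∀ Y ∈ H k, ⟪ContinuousMap.toLp 2 ρ ℝ Y, f⟫ = 0) → f = 0)
    {M j : ℕ} (hpos : 0 < K.eigenvalue ρ j)
    (hj : Module.finrank ℝ ((Finset.range (M + 1)).sup H : Submodule ℝ C(X, ℝ)) < j) :
    K.eigenvalue ρ j ≤ ev (M + 1) := by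
  by_contra! hlt
  obtain ⟨t, ht', hrank⟩ := K.exists_lt_rank_of_lt_eigenvalue ρ
    (le_max_left 0 (ev (M + 1))) (max_lt hpos hlt)
  have ht : ev (M + 1) < t := (le_max_right _ _).trans_lt ht'
  set V : Submodule ℝ C(X, ℝ) := (Finset.range (M + 1)).sup H with hV
  have hVfin : FiniteDimensional ℝ V := Submodule.finiteDimensional_finset_sup _ _
  set J : C(X, ℝ) →ₗ[ℝ] Lp ℝ 2 ρ :=
    (ContinuousMap.toLp 2 ρ ℝ : C(X, ℝ) →L[ℝ] Lp ℝ 2 ρ).toLinearMap with hJ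
  -- only the `H k` with `ev k ≥ t` are used, so that the remaining ones are orthogonal to them
  classical
  set I : Finset ℕ := (Finset.range (M + 1)).filter fun k => t ≤ ev k with hI
  set U : Submodule ℝ (Lp ℝ 2 ρ) := (I.sup H).map J with hU
  have hUV : U ≤ V.map J := Submodule.map_mono (Finset.sup_mono (Finset.filter_subset _ _))
  have hUfin : FiniteDimensional ℝ U := Submodule.finiteDimensional_of_le hUV
  have hlow : ∀ k, k ∉ I → ev k < t := by
    intro k hk
    by_contra! h
    by_cases hkM : k < M + 1
    · exact hk (by simp [hI, hkM, h])
    · exact absurd (hanti (not_lt.mp hkM)) (not_le.mpr (ht.trans_le h))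
  have hsub : K.spectralSpan ρ t ≤ U := by
    refine iSup₂_le fun ν hν f hf => ?_
    have hzero : f - U.starProjection f = 0 := by
      refine hdense _ fun k Y hY => ?_
      by_cases hk : k ∈ I
      · refine (U.mem_orthogonal _).mp (Submodule.sub_starProjection_mem_orthogonal f) _ ?_
        exact ⟨Y, (Finset.le_sup (f := H) hk) hY, rfl⟩
      · have hYe := K.toLp_mem_eigenspace ρ (hev k Y hY)
        have hUperp : ∀ u ∈ U, ⟪ContinuousMap.toLp 2 ρ ℝ Y, u⟫ = 0 := by
          rintro _ ⟨Z, hZ, rfl⟩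
          have : I.sup H ≤ (LinearMap.ker (innerₛₗ ℝ (ContinuousMap.toLp 2 ρ ℝ Y))).comap J := by
            refine Finset.sup_le fun k' hk' Z hZ => ?_
            refine K.inner_eq_zero_of_mem_eigenspace ρ ?_ hYe
              (K.toLp_mem_eigenspace ρ (hev k' Z hZ))
            have h1 : t ≤ ev k' := (Finset.mem_filter.mp hk').2
            exact ((hlow k hk).trans_le h1).ne
          exact this hZ
        rw [inner_sub_right, hUperp _ (Submodule.starProjection_apply_mem _ _), sub_zero]
        exact K.inner_eq_zero_of_mem_eigenspace ρ ((hlow k hk).trans_le hν).ne hYe hf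
    rw [sub_eq_zero.mp hzero]
    exact Submodule.starProjection_apply_mem _ _
  have h1 : (j : Cardinal) ≤ Module.rank ℝ (V.map J) :=
    hrank.trans (Submodule.rank_mono (hsub.trans hUV))
  rw [← Module.finrank_eq_rank, Nat.cast_le] at h1
  exact absurd (h1.trans (Submodule.finrank_map_le J V)) hj.not_ge

theorem eigenvalue_one_eq [ρ.IsOpenPosMeasure] [NeZero ρ]
    (hev : ∀ k, ∀ Y ∈ H k, ∀ x, ∫ y, K.toFun x y * Y y ∂ρ = ev k * Y x) (hanti : Antitone ev)
    (hdense : ∀ f : Lp ℝ 2 ρ, (∀ k, ∀ Y ∈ H k, ⟪ContinuousMap.toLp 2 ρ ℝ Y, f⟫ = 0) → f = 0)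
    (hone : (1 : C(X, ℝ)) ∈ H 0) (h0 : 0 < ev 0) : K.eigenvalue ρ 1 = ev 0 := by
  set A := {t : ℝ | 0 < t ∧ ((1 : ℕ) : Cardinal) ≤
      Module.rank ℝ ↥(⨆ ν ∈ Set.Ici t, K.eigenspace ρ ν)} with hA
  have hupper : ∀ t ∈ A, t ≤ ev 0 := by
    rintro t ⟨-, ht⟩
    by_contra! hlt
    have hbot : (⨆ ν ∈ Set.Ici t, K.eigenspace ρ ν) = ⊥ := by
      refine (Submodule.eq_bot_iff _).mpr fun f hf => ?_
      have : (⨆ ν ∈ Set.Ici t, K.eigenspace ρ ν) ≤ ⊥ := by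
        refine iSup₂_le fun ν hν f hf => ?_
        refine (Submodule.mem_bot ℝ).mpr (hdense f fun k Y hY => ?_)
        exact K.inner_eq_zero_of_mem_eigenspace ρ
          (((hanti k.zero_le).trans_lt hlt).trans_le hν).ne
          (K.toLp_mem_eigenspace ρ (hev k Y hY)) hf
      exact (Submodule.mem_bot ℝ).mp (this hf)
    rw [hbot, rank_bot] at ht
    simp at ht
  have hmem : ev 0 ∈ A := by
    refine ⟨h0, ?_⟩
    rw [Nat.cast_one, Cardinal.one_le_iff_ne_zero, Ne, rank_eq_zero_iff]
    intro h
    obtain ⟨a, ha, hz⟩ := h ⟨_, K.eigenspace_le_spectralSpan ρ le_rfl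
      (K.toLp_mem_eigenspace ρ (hev 0 1 hone))⟩
    have hz' : ContinuousMap.toLp 2 ρ ℝ (1 : C(X, ℝ)) = 0 := by
      have := congrArg Subtype.val ((smul_eq_zero.mp hz).resolve_left ha)
      simpa using this
    have h1 : (1 : C(X, ℝ)) = 0 :=
      ContinuousMap.toLp_injective ρ (p := 2) (𝕜 := ℝ) (hz'.trans (map_zero _).symm)
    have hX : Nonempty X := by
      by_contra hX
      rw [not_nonempty_iff] at hX
      exact NeZero.ne ρ (Measure.eq_zero_of_isEmpty ρ)
    exact one_ne_zero (congrArg (fun f : C(X, ℝ) => f hX.some) h1)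
  exact le_antisymm (csSup_le ⟨_, hmem⟩ hupper) (le_csSup ⟨_, hupper⟩ hmem)

/-- The lower bound on a ball for a kernel that is diagonalised by a transitive, multiplicative
filtration `H 0 ⊆ H 0 + H 1 ⊆ …` of doubling dimension. -/
theorem le_ballErrorSq [T2Space X] [IsProbabilityMeasure ρ] [ρ.IsOpenPosMeasure]
    [∀ k, FiniteDimensional ℝ (H k)]
    (hev : ∀ k, ∀ Y ∈ H k, ∀ x, ∫ y, K.toFun x y * Y y ∂ρ = ev k * Y x) (hanti : Antitone ev)
    (hsep : ∀ x y, x ≠ y → ∃ k, ∃ Y ∈ H k, Y x ≠ Y y)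
    (hzero : H 0 = Submodule.span ℝ {1})
    (hmul : ∀ m, ∀ f ∈ (Finset.range (m + 1)).sup H, ∀ g ∈ (Finset.range (m + 1)).sup H,
      f * g ∈ (Finset.range (2 * m + 1)).sup H)
    (hinv : ∀ x y, ∃ φ : C(X, X), φ x = y ∧ MeasurePreserving φ ρ ρ ∧
      ∀ m, ∀ f ∈ (Finset.range (m + 1)).sup H, f.comp φ ∈ (Finset.range (m + 1)).sup H)
    (hgrow : ∀ N : ℕ, ∃ m, N ≤
      Module.finrank ℝ ((Finset.range (m + 1)).sup H : Submodule ℝ C(X, ℝ)))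
    {A : ℕ} (hA : 0 < A) (hdim : ∀ m,
      Module.finrank ℝ ((Finset.range (2 * m + 2)).sup H : Submodule ℝ C(X, ℝ)) ≤
        A * Module.finrank ℝ ((Finset.range (m + 1)).sup H : Submodule ℝ C(X, ℝ)))
    {n : ℕ} (hn : 0 < n) {q : X → ℝ} {x : Fin n → X} (hq : ∀ i, 0 < q (x i)) {lam : ℝ}
    (hlam : 0 ≤ lam) (s : ℝ) {p : ℝ} (hp : p ≤ 2)
    (h2 : p = 2 → 0 < K.eigenvalue ρ (2 * A * n)) :
    ENNReal.ofReal (1 / 2 * K.eigenvalue ρ (2 * A * n) ^ (2 - p)) ≤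
      K.ballErrorSq ρ q x lam s p (K.eigenvalue ρ 1 ^ (2 - s)) := by
  rcases (K.eigenvalue_nonneg ρ (2 * A * n)).eq_or_lt with h0 | hpos
  · have hp' : 2 - p ≠ 0 := fun h => (h2 (by linarith)).ne h0
    rw [← h0, Real.zero_rpow hp']
    simp
  have hone : (1 : C(X, ℝ)) ∈ H 0 := hzero ▸ Submodule.mem_span_singleton_self _
  have hdense := eq_zero_of_inner_eq_zero_of_separates ρ hone hmul hsep
  have hVfin : ∀ m, FiniteDimensional ℝ ((Finset.range (m + 1)).sup H : Submodule ℝ C(X, ℝ)) :=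
    fun m => Submodule.finiteDimensional_finset_sup _ _
  classical
  set m := Nat.find (hgrow (2 * n)) with hm
  have hmdim := Nat.find_spec (hgrow (2 * n))
  have hm0 : m ≠ 0 := by
    intro hm0
    rw [← hm, hm0, Finset.range_one, Finset.sup_singleton, hzero] at hmdim
    have h1 := finrank_span_le_card (R := ℝ) ({1} : Set C(X, ℝ))
    simp only [Set.toFinset_singleton, Finset.card_singleton] at h1
    omega
  obtain ⟨j, hj⟩ := Nat.exists_eq_succ_of_ne_zero hm0
  have hjdim := Nat.find_min (hgrow (2 * n)) (m := j) (by omega)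
  have hμ : K.eigenvalue ρ (2 * A * n) ≤ ev (2 * m) := by
    have : 2 * m = (2 * j + 1) + 1 := by omega
    rw [this]
    refine K.eigenvalue_le_of_finrank_lt ρ hev hanti hdense hpos ?_
    refine (hdim j).trans_lt ?_
    calc _ < A * (2 * n) := Nat.mul_lt_mul_of_pos_left (not_le.mp hjdim) hA
      _ = 2 * A * n := by ring
  have hpos0 : 0 < ev 0 := hpos.trans_le (hμ.trans (hanti (Nat.zero_le _)))
  rw [K.eigenvalue_one_eq ρ hev hanti hdense hone hpos0]
  obtain ⟨N, w, hwV, hwx, hwpos, hw⟩ := exists_test_function ρ hn x _ hmdim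
    fun f hf x => sq_apply_le_finrank_mul_integral ρ _ (fun x y => by
      obtain ⟨φ, h1, h2, h3⟩ := hinv x y
      exact ⟨φ, h1, h2, h3 _⟩) hf x
  refine K.le_ballErrorSq_of_test ρ hq hlam s hp hpos0 hpos
    (fun x => by simpa using hev 0 1 hone x) _ (fun i => ?_) ?_ hwpos hw
  · simp [ContinuousMap.sum_apply, hwx]
  · rw [map_sum]
    refine Submodule.sum_mem _ fun l _ => ?_
    have hle : (Finset.range (2 * m + 1)).sup H ≤ (K.spectralSpan ρ
        (K.eigenvalue ρ (2 * A * n))).comap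
        (ContinuousMap.toLp 2 ρ ℝ : C(X, ℝ) →L[ℝ] Lp ℝ 2 ρ).toLinearMap := by
      refine Finset.sup_le fun k hk Y hY => ?_
      refine K.eigenspace_le_spectralSpan ρ (hμ.trans (hanti ?_))
        (K.toLp_mem_eigenspace ρ (hev k Y hY))
      have := Finset.mem_range.mp hk
      omega
    exact hle (hmul m _ (hwV l) _ (hwV l))

end Spectrum
end PSDKernel

/-! ### Periodic kernels on the torus -/

theorem finrank_finset_sup_le_sum {ι E : Type*} [AddCommGroup E] [Module ℝ E]
    (H : ι → Submodule ℝ E) [∀ k, FiniteDimensional ℝ (H k)] (s : Finset ι) :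
    Module.finrank ℝ (s.sup H : Submodule ℝ E) ≤ ∑ k ∈ s, Module.finrank ℝ (H k) := by
  classical
  induction s using Finset.induction_on with
  | empty => simp
  | insert a s ha ih =>
    have : FiniteDimensional ℝ (s.sup H : Submodule ℝ E) :=
      Submodule.finiteDimensional_finset_sup _ _
    rw [Finset.sup_insert, Finset.sum_insert ha]
    exact (Submodule.finrank_add_le_finrank_add_finrank _ _).trans (by gcongr)

section Torus

/-- The function `t ↦ cos (2πkt)` on the torus. -/
def torusCos (k : ℤ) : C(UnitAddCircle, ℝ) :=
  ⟨fun t => (fourier k t).re, Complex.continuous_re.comp (fourier k).continuous⟩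

/-- The function `t ↦ sin (2πkt)` on the torus. -/
def torusSin (k : ℤ) : C(UnitAddCircle, ℝ) :=
  ⟨fun t => (fourier k t).im, Complex.continuous_im.comp (fourier k).continuous⟩

theorem torusCos_apply (k : ℤ) (t : UnitAddCircle) : torusCos k t = (fourier k t).re := rfl
theorem torusSin_apply (k : ℤ) (t : UnitAddCircle) : torusSin k t = (fourier k t).im := rfl

theorem torusCos_add (a b : ℤ) (t : UnitAddCircle) :
    torusCos (a + b) t = torusCos a t * torusCos b t - torusSin a t * torusSin b t := by
  simp only [torusCos_apply, torusSin_apply, fourier_add, Complex.mul_re]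

theorem torusSin_add (a b : ℤ) (t : UnitAddCircle) :
    torusSin (a + b) t = torusCos a t * torusSin b t + torusSin a t * torusCos b t := by
  simp only [torusCos_apply, torusSin_apply, fourier_add, Complex.mul_im]

theorem torusCos_neg (a : ℤ) (t : UnitAddCircle) : torusCos (-a) t = torusCos a t := by
  simp only [torusCos_apply, fourier_neg, Complex.conj_re]

theorem torusSin_neg (a : ℤ) (t : UnitAddCircle) : torusSin (-a) t = -torusSin a t := by
  simp only [torusSin_apply, fourier_neg, Complex.conj_im]

theorem fourier_add_point (k : ℤ) (t u : UnitAddCircle) :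
    fourier k (t + u) = fourier k t * fourier k u := by
  simp only [fourier_apply, smul_add, AddCircle.toCircle_add, Circle.coe_mul]

theorem torusCos_add_point (k : ℤ) (t u : UnitAddCircle) :
    torusCos k (t + u) = torusCos k t * torusCos k u - torusSin k t * torusSin k u := by
  simp only [torusCos_apply, torusSin_apply, fourier_add_point, Complex.mul_re]

theorem torusSin_add_point (k : ℤ) (t u : UnitAddCircle) :
    torusSin k (t + u) = torusCos k t * torusSin k u + torusSin k t * torusCos k u := by
  simp only [torusCos_apply, torusSin_apply, fourier_add_point, Complex.mul_im]

theorem fourier_neg_point (k : ℤ) (t : UnitAddCircle) : fourier k (-t) = fourier (-k) t := by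
  simp only [fourier_apply, smul_neg, neg_smul]

theorem torusCos_neg_point (k : ℤ) (t : UnitAddCircle) : torusCos k (-t) = torusCos k t := by
  rw [torusCos_apply, fourier_neg_point, ← torusCos_apply, torusCos_neg]

theorem torusSin_neg_point (k : ℤ) (t : UnitAddCircle) : torusSin k (-t) = -torusSin k t := by
  rw [torusSin_apply, fourier_neg_point, ← torusSin_apply, torusSin_neg]

theorem torusCos_zero : torusCos 0 = 1 := by
  ext t; simp [torusCos_apply]

theorem torusSin_zero : torusSin 0 = 0 := by
  ext t; simp [torusSin_apply]

/-- The trigonometric functions of frequency `k`. -/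
def torusHarmonics (k : ℕ) : Submodule ℝ C(UnitAddCircle, ℝ) :=
  Submodule.span ℝ {torusCos k, torusSin k}

instance (k : ℕ) : FiniteDimensional ℝ (torusHarmonics k) :=
  FiniteDimensional.span_of_finite ℝ (Set.toFinite _)

theorem finrank_torusHarmonics_le (k : ℕ) : Module.finrank ℝ (torusHarmonics k) ≤ 2 := by
  classical
  refine (finrank_span_le_card _).trans ?_
  rw [Set.toFinset_insert, Set.toFinset_singleton]
  exact Finset.card_le_two

/-- The trigonometric polynomials of degree at most `m`. -/
abbrev torusPoly (m : ℕ) : Submodule ℝ C(UnitAddCircle, ℝ) :=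
  (Finset.range (m + 1)).sup torusHarmonics

theorem torus_mem {m : ℕ} {z : ℤ} (hz : z.natAbs ≤ m) :
    torusCos z ∈ torusPoly m ∧ torusSin z ∈ torusPoly m := by
  have hle : torusHarmonics z.natAbs ≤ torusPoly m :=
    Finset.le_sup (f := torusHarmonics) (Finset.mem_range.mpr (by omega))
  have hc : torusCos z.natAbs ∈ torusPoly m := hle (Submodule.subset_span (by simp))
  have hs : torusSin z.natAbs ∈ torusPoly m := hle (Submodule.subset_span (by simp))
  rcases Int.natAbs_eq z with h | h
  · rw [← h] at hc hs
    exact ⟨hc, hs⟩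
  · have e1 : torusCos z = torusCos z.natAbs := by
      ext t; conv_lhs => rw [h, torusCos_neg]
    have e2 : torusSin z = -torusSin z.natAbs := by
      ext t; conv_lhs => rw [h, torusSin_neg]
      rfl
    rw [e1, e2]
    exact ⟨hc, Submodule.neg_mem _ hs⟩

theorem torusPoly_le {m : ℕ} {P : Submodule ℝ C(UnitAddCircle, ℝ)}
    (h : ∀ k : ℕ, k ≤ m → torusCos k ∈ P ∧ torusSin k ∈ P) : torusPoly m ≤ P := by
  refine Finset.sup_le fun k hk => Submodule.span_le.mpr ?_
  have := h k (by have := Finset.mem_range.mp hk; omega)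
  rintro _ (rfl | rfl)
  · exact this.1
  · exact this.2

theorem torus_mul_mem {m : ℕ} {a b : ℕ} (ha : a ≤ m) (hb : b ≤ m) :
    (torusCos a * torusCos b ∈ torusPoly (2 * m) ∧ torusCos a * torusSin b ∈ torusPoly (2 * m)) ∧
    (torusSin a * torusCos b ∈ torusPoly (2 * m) ∧
      torusSin a * torusSin b ∈ torusPoly (2 * m)) := by
  obtain ⟨hc1, hs1⟩ := torus_mem (m := 2 * m) (z := (a : ℤ) + b) (by omega)
  obtain ⟨hc2, hs2⟩ := torus_mem (m := 2 * m) (z := (a : ℤ) + -b) (by omega)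
  have e1 : torusCos a * torusCos b
      = (1 / 2 : ℝ) • (torusCos ((a : ℤ) + b) + torusCos ((a : ℤ) + -b)) := by
    ext t
    simp only [ContinuousMap.mul_apply, ContinuousMap.smul_apply, ContinuousMap.add_apply,
      torusCos_add, torusCos_neg, torusSin_neg, smul_eq_mul]
    ring
  have e2 : torusCos a * torusSin b
      = (1 / 2 : ℝ) • (torusSin ((a : ℤ) + b) - torusSin ((a : ℤ) + -b)) := by
    ext t
    simp only [ContinuousMap.mul_apply, ContinuousMap.smul_apply, ContinuousMap.sub_apply,
      torusSin_add, torusCos_neg, torusSin_neg, smul_eq_mul]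
    ring
  have e3 : torusSin a * torusCos b
      = (1 / 2 : ℝ) • (torusSin ((a : ℤ) + b) + torusSin ((a : ℤ) + -b)) := by
    ext t
    simp only [ContinuousMap.mul_apply, ContinuousMap.smul_apply, ContinuousMap.add_apply,
      torusSin_add, torusCos_neg, torusSin_neg, smul_eq_mul]
    ring
  have e4 : torusSin a * torusSin b
      = (1 / 2 : ℝ) • (torusCos ((a : ℤ) + -b) - torusCos ((a : ℤ) + b)) := by
    ext t
    simp only [ContinuousMap.mul_apply, ContinuousMap.smul_apply, ContinuousMap.sub_apply,
      torusCos_add, torusCos_neg, torusSin_neg, smul_eq_mul]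
    ring
  rw [e1, e2, e3, e4]
  exact ⟨⟨Submodule.smul_mem _ _ (Submodule.add_mem _ hc1 hc2),
    Submodule.smul_mem _ _ (Submodule.sub_mem _ hs1 hs2)⟩,
    Submodule.smul_mem _ _ (Submodule.add_mem _ hs1 hs2),
    Submodule.smul_mem _ _ (Submodule.sub_mem _ hc2 hc1)⟩

theorem torusPoly_mul_mem {m : ℕ} {f g : C(UnitAddCircle, ℝ)} (hf : f ∈ torusPoly m)
    (hg : g ∈ torusPoly m) : f * g ∈ torusPoly (2 * m) := by
  refine torusPoly_le (P := (torusPoly (2 * m)).comap (LinearMap.mulRight ℝ g)) (fun a ha => ?_) hf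
  constructor
  · exact torusPoly_le (P := (torusPoly (2 * m)).comap (LinearMap.mulLeft ℝ (torusCos a)))
      (fun b hb => (torus_mul_mem ha hb).1) hg
  · exact torusPoly_le (P := (torusPoly (2 * m)).comap (LinearMap.mulLeft ℝ (torusSin a)))
      (fun b hb => (torus_mul_mem ha hb).2) hg

theorem torusPoly_comp_add_mem {m : ℕ} {f : C(UnitAddCircle, ℝ)} (hf : f ∈ torusPoly m)
    (a : UnitAddCircle) : f.comp ⟨fun t => t + a, continuous_add_const a⟩ ∈ torusPoly m := by
  set φ : C(UnitAddCircle, UnitAddCircle) := ⟨fun t => t + a, continuous_add_const a⟩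
  refine torusPoly_le
    (P := (torusPoly m).comap (ContinuousMap.compRightAlgHom ℝ ℝ φ).toLinearMap) (fun k hk => ?_) hf
  obtain ⟨hc, hs⟩ := torus_mem (m := m) (z := (k : ℤ)) (by omega)
  have e1 : (torusCos k).comp φ = torusCos k a • torusCos k - torusSin k a • torusSin k := by
    ext t
    change torusCos k (t + a) = torusCos k a * torusCos k t - torusSin k a * torusSin k t
    rw [torusCos_add_point]; ring
  have e2 : (torusSin k).comp φ = torusSin k a • torusCos k + torusCos k a • torusSin k := by
    ext t
    change torusSin k (t + a) = torusSin k a * torusCos k t + torusCos k a * torusSin k t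
    rw [torusSin_add_point]; ring
  change (torusCos k).comp φ ∈ torusPoly m ∧ (torusSin k).comp φ ∈ torusPoly m
  rw [e1, e2]
  exact ⟨Submodule.sub_mem _ (Submodule.smul_mem _ _ hc) (Submodule.smul_mem _ _ hs),
    Submodule.add_mem _ (Submodule.smul_mem _ _ hc) (Submodule.smul_mem _ _ hs)⟩

theorem integral_torusCos {k : ℤ} (hk : k ≠ 0) :
    ∫ t, torusCos k t ∂AddCircle.haarAddCircle = 0 := by
  -- translate by half a period
  have h := integral_add_right_eq_self (μ := (AddCircle.haarAddCircle : Measure UnitAddCircle))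
    (fun t => torusCos k t) (((1 : ℝ) / 2 / k : ℝ) : UnitAddCircle)
  have h2 : ∀ t : UnitAddCircle,
      torusCos k (t + (((1 : ℝ) / 2 / k : ℝ) : UnitAddCircle)) = -torusCos k t := by
    intro t
    have := fourier_add_half_inv_index (T := 1) hk one_pos t
    rw [torusCos_apply, this, Complex.neg_re]
    rfl
  simp_rw [h2, integral_neg] at h
  linarith

theorem finrank_torusPoly_ge (m : ℕ) : m + 1 ≤ Module.finrank ℝ (torusPoly m) := by
  set ρ : Measure UnitAddCircle := AddCircle.haarAddCircle
  have hinj : Function.Injective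
      (ContinuousMap.toLp 2 ρ ℝ : C(UnitAddCircle, ℝ) →L[ℝ] Lp ℝ 2 ρ) :=
    ContinuousMap.toLp_injective ρ
  have hlin : LinearIndependent ℝ fun k : Fin (m + 1) => torusCos ((k : ℕ) : ℤ) := by
    refine LinearIndependent.of_comp
      (ContinuousMap.toLp 2 ρ ℝ : C(UnitAddCircle, ℝ) →L[ℝ] Lp ℝ 2 ρ).toLinearMap ?_
    refine linearIndependent_of_ne_zero_of_inner_eq_zero (fun k hk => ?_) fun j k hjk => ?_
    · have h0 : torusCos ((k : ℕ) : ℤ) = 0 := hinj (hk.trans (map_zero _).symm)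
      have h1 := congrArg (fun f : C(UnitAddCircle, ℝ) => f 0) h0
      simp [torusCos_apply] at h1
    · have hjk' : ((j : ℕ) : ℤ) ≠ (k : ℕ) := fun h => hjk (Fin.ext (by exact_mod_cast h))
      refine (inner_toLp_toLp ρ _ _).trans ?_
      have e : ∀ t : UnitAddCircle, torusCos ((j : ℕ) : ℤ) t * torusCos ((k : ℕ) : ℤ) t
          = 1 / 2 * (torusCos ((j : ℕ) + (k : ℕ) : ℤ) t + torusCos ((j : ℕ) + -(k : ℕ) : ℤ) t) := by
        intro t
        simp only [torusCos_add, torusCos_neg, torusSin_neg]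
        ring
      simp_rw [e]
      rw [integral_const_mul, integral_add (integrable_continuousMap ρ _)
        (integrable_continuousMap ρ _), integral_torusCos (by omega), integral_torusCos (by omega)]
      ring
  have h1 := finrank_span_eq_card hlin
  rw [Fintype.card_fin] at h1
  have hfin : FiniteDimensional ℝ (torusPoly m) := Submodule.finiteDimensional_finset_sup _ _
  rw [← h1]
  refine Submodule.finrank_mono (Submodule.span_le.mpr ?_)
  rintro _ ⟨k, rfl⟩
  exact (torus_mem (by have := k.2; omega)).1

theorem finrank_torusPoly_le (m : ℕ) : Module.finrank ℝ (torusPoly m) ≤ 2 * (m + 1) := by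
  refine (finrank_finset_sup_le_sum _ _).trans
    ((Finset.sum_le_sum fun k _ => finrank_torusHarmonics_le k).trans_eq ?_)
  simp [mul_comm]

variable {K : PSDKernel UnitAddCircle} {κ : UnitAddCircle → ℝ}

theorem integral_periodicKernel_mul (hK : ∀ x y : UnitAddCircle, K.toFun x y = κ (x - y)) (k : ℕ)
    {Y : C(UnitAddCircle, ℝ)} (hY : Y ∈ torusHarmonics k) (x : UnitAddCircle) :
    ∫ y, K.toFun x y * Y y ∂AddCircle.haarAddCircle = periodicEigenvalue κ k * Y x := by
  set ρ : Measure UnitAddCircle := AddCircle.haarAddCircle with hρ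
  have hκ : ∀ t, κ t = K.toFun t 0 := fun t => by rw [hK, sub_zero]
  have hκc : Continuous κ := by
    rw [funext hκ]
    exact K.continuous_toFun.comp
      (by fun_prop : Continuous fun t : UnitAddCircle => (t, (0 : UnitAddCircle)))
  have hκneg : ∀ t, κ (-t) = κ t := fun t => by
    rw [hκ t, K.symm, hK, zero_sub]
  have hint : ∀ f : C(UnitAddCircle, ℝ), Integrable (fun t => κ t * f t) ρ := fun f =>
    (hκc.mul f.continuous).integrable_of_hasCompactSupport (HasCompactSupport.of_compactSpace _)
  have hsin : ∫ t, κ t * torusSin k t ∂ρ = 0 := by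
    have h := integral_neg_eq_self (fun t => κ t * torusSin k t) ρ
    simp_rw [hκneg, torusSin_neg_point, mul_neg, integral_neg] at h
    linarith
  have hfint : Integrable (fun t => fourier (-(k : ℤ)) t • (κ t : ℂ)) ρ := by
    have hc : Continuous fun t => fourier (-(k : ℤ)) t • (κ t : ℂ) :=
      Continuous.mul (fourier _).continuous (Complex.continuous_ofReal.comp hκc)
    exact hc.integrable_of_hasCompactSupport (HasCompactSupport.of_compactSpace _)
  have hcos : ∫ t, κ t * torusCos k t ∂ρ = periodicEigenvalue κ k := by
    have h := integral_re (𝕜 := ℂ) hfint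
    rw [periodicEigenvalue, fourierCoeff]
    refine Eq.trans (integral_congr_ae (Filter.Eventually.of_forall fun t => ?_)) h
    simp only [RCLike.re_eq_complex_re, smul_eq_mul, Complex.re_mul_ofReal, ← torusCos_apply,
      torusCos_neg]
    ring
  have hsub : ∀ f : UnitAddCircle → ℝ,
      ∫ y, K.toFun x y * f y ∂ρ = ∫ t, κ t * f (x - t) ∂ρ := fun f => by
    rw [← integral_sub_left_eq_self (fun t => κ t * f (x - t)) ρ x]
    simp only [hK, sub_sub_cancel]
  have hbase : ∀ f ∈ ({torusCos k, torusSin k} : Set C(UnitAddCircle, ℝ)),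
      ∫ t, κ t * f (x - t) ∂ρ = periodicEigenvalue κ k * f x := by
    rintro _ (rfl | rfl)
    · have e : ∀ t, κ t * torusCos k (x - t) = torusCos k x * (κ t * torusCos k t)
          + torusSin k x * (κ t * torusSin k t) := fun t => by
        rw [sub_eq_add_neg, torusCos_add_point, torusCos_neg_point, torusSin_neg_point]; ring
      simp_rw [e]
      rw [integral_add ((hint _).const_mul _) ((hint _).const_mul _), integral_const_mul,
        integral_const_mul, hsin, hcos]
      ring
    · have e : ∀ t, κ t * torusSin k (x - t) = torusSin k x * (κ t * torusCos k t)
          + -torusCos k x * (κ t * torusSin k t) := fun t => by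
        rw [sub_eq_add_neg, torusSin_add_point, torusCos_neg_point, torusSin_neg_point]; ring
      simp_rw [e]
      rw [integral_add ((hint _).const_mul _) ((hint _).const_mul _), integral_const_mul,
        integral_const_mul, hsin, hcos]
      ring
  rw [hsub]
  have hintx : ∀ f : C(UnitAddCircle, ℝ), Integrable (fun t => κ t * f (x - t)) ρ := fun f =>
    hint (f.comp ⟨fun t => x - t, continuous_const.sub continuous_id⟩)
  induction hY using Submodule.span_induction with
  | mem f hf => exact hbase f hf
  | zero => simp
  | add f g _ _ hf hg =>
    simp only [ContinuousMap.add_apply, mul_add]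
    rw [integral_add (hintx f) (hintx g), hf, hg]
  | smul c f _ hf =>
    simp only [ContinuousMap.smul_apply, smul_eq_mul, mul_left_comm _ c]
    rw [integral_const_mul, hf]

theorem PSDKernel.le_ballErrorSq_torus (hK : ∀ x y : UnitAddCircle, K.toFun x y = κ (x - y))
    (hanti : Antitone (periodicEigenvalue κ))
    {n : ℕ} (hn : 0 < n) {q : UnitAddCircle → ℝ} {x : Fin n → UnitAddCircle}
    (hq : ∀ i, 0 < q (x i)) {lam : ℝ} (hlam : 0 ≤ lam) (s : ℝ) {p : ℝ} (hp : p ≤ 2)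
    (h2 : p = 2 → 0 < K.eigenvalue AddCircle.haarAddCircle (8 * n)) :
    ENNReal.ofReal (1 / 2 * K.eigenvalue AddCircle.haarAddCircle (8 * n) ^ (2 - p)) ≤
      K.ballErrorSq AddCircle.haarAddCircle q x lam s p
        (K.eigenvalue AddCircle.haarAddCircle 1 ^ (2 - s)) := by
  refine K.le_ballErrorSq AddCircle.haarAddCircle (H := torusHarmonics) (A := 4)
    (fun k Y hY x => integral_periodicKernel_mul hK k hY x) hanti ?_ ?_
    (fun m f hf g hg => torusPoly_mul_mem hf hg) ?_ ?_ (by norm_num) ?_ hn hq hlam s hp h2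
  · intro x y hxy
    by_contra! hcon
    refine hxy (AddCircle.injective_toCircle one_ne_zero (Circle.ext ?_))
    rw [← fourier_one, ← fourier_one]
    refine Complex.ext ?_ ?_
    · exact hcon 1 (torusCos 1) (Submodule.subset_span (by simp))
    · exact hcon 1 (torusSin 1) (Submodule.subset_span (by simp))
  · rw [torusHarmonics, Nat.cast_zero, torusCos_zero, torusSin_zero, Set.pair_comm,
      Submodule.span_insert_zero]
  · intro x y
    exact ⟨⟨fun t => t + (y - x), continuous_add_const _⟩, add_sub_cancel x y,
      measurePreserving_add_right _ _, fun m f hf => torusPoly_comp_add_mem hf _⟩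
  · exact fun N => ⟨N, (Nat.le_succ N).trans (finrank_torusPoly_ge N)⟩
  · intro m
    have h1 := finrank_torusPoly_le (2 * m + 1)
    have h2 := finrank_torusPoly_ge m
    change Module.finrank ℝ (torusPoly (2 * m + 1)) ≤ 4 * Module.finrank ℝ (torusPoly m)
    omega

end Torus

/-! ### Harmonic polynomials -/

namespace MvPolynomial
section Harmonic
variable {σ : Type*} [Fintype σ]

/-- The Laplacian on real polynomials. -/
def laplacian : MvPolynomial σ ℝ →ₗ[ℝ] MvPolynomial σ ℝ :=
  ∑ i, (pderiv i : Derivation ℝ (MvPolynomial σ ℝ) (MvPolynomial σ ℝ)).toLinearMap ∘ₗ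
    (pderiv i : Derivation ℝ (MvPolynomial σ ℝ) (MvPolynomial σ ℝ)).toLinearMap

theorem laplacian_apply (P : MvPolynomial σ ℝ) : laplacian P = ∑ i, pderiv i (pderiv i P) := by
  simp [laplacian, LinearMap.sum_apply]

/-- The squared radius `∑ᵢ Xᵢ²`. -/
def radiusSq : MvPolynomial σ ℝ := ∑ i, X i ^ 2

theorem isHomogeneous_radiusSq : (radiusSq : MvPolynomial σ ℝ).IsHomogeneous 2 :=
  IsHomogeneous.sum _ _ _ fun i _ => isHomogeneous_X_pow i 2

theorem IsHomogeneous.laplacian {P : MvPolynomial σ ℝ} {k : ℕ} (hP : P.IsHomogeneous k) :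
    (laplacian P).IsHomogeneous (k - 2) := by
  rw [laplacian_apply]
  exact IsHomogeneous.sum _ _ _ fun i _ => hP.pderiv.pderiv

theorem laplacian_eq_zero_of_lt_two {P : MvPolynomial σ ℝ} {k : ℕ} (hP : P.IsHomogeneous k)
    (hk : k < 2) : MvPolynomial.laplacian P = 0 := by
  rw [laplacian_apply]
  refine Finset.sum_eq_zero fun i _ => ?_
  have h0 : (pderiv i P).IsHomogeneous 0 := by
    have := hP.pderiv (i := i)
    rwa [show k - 1 = 0 by omega] at this
  rw [totalDegree_eq_zero_iff_eq_C.mp (Nat.le_zero.mp h0.totalDegree_le), pderiv_C]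

theorem pderiv_radiusSq (i : σ) : pderiv i (radiusSq : MvPolynomial σ ℝ) = 2 * X i := by
  classical
  rw [radiusSq, map_sum, Finset.sum_eq_single_of_mem i (Finset.mem_univ i)]
  · simp
  · intro j _ hj
    rw [pderiv_pow, pderiv_X_of_ne hj, mul_zero]

theorem laplacian_radiusSq_mul {Q : MvPolynomial σ ℝ} {k : ℕ} (hQ : Q.IsHomogeneous k) :
    laplacian (radiusSq * Q) =
      ((2 * Fintype.card σ + 4 * k : ℕ) : MvPolynomial σ ℝ) * Q + radiusSq * laplacian Q := by
  have h : ∀ i, pderiv i (pderiv i (radiusSq * Q)) =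
      2 * Q + 4 * (X i * pderiv i Q) + radiusSq * pderiv i (pderiv i Q) := by
    intro i
    have h2 : pderiv i (2 : MvPolynomial σ ℝ) = 0 := (pderiv i).map_natCast 2
    simp only [pderiv_mul, map_add, pderiv_radiusSq, pderiv_X_self, h2]
    ring
  rw [laplacian_apply, laplacian_apply, Finset.sum_congr rfl fun i _ => h i,
    Finset.sum_add_distrib, Finset.sum_add_distrib, ← Finset.mul_sum, ← Finset.mul_sum,
    ← Finset.mul_sum,    hQ.sum_X_mul_pderiv, Finset.sum_const, Finset.card_univ]
  simp only [nsmul_eq_mul]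
  push_cast
  ring

/-- If `|x|² ΔQ = -c Q` with `c > 0`, then `Q` is divisible by `|x|²` and the quotient satisfies an
equation of the same kind, so that `Q = 0` by descent on the degree. -/
theorem eq_zero_of_radiusSq_mul_laplacian [Nonempty σ] (k : ℕ) :
    ∀ (c : ℝ) (Q : MvPolynomial σ ℝ), 0 < c → Q.IsHomogeneous k →
      radiusSq * laplacian Q = -(C c * Q) → Q = 0 := by
  induction k using Nat.strong_induction_on with
  | _ k ih =>
    intro c Q hc hQ h
    have hCc : (C c : MvPolynomial σ ℝ) ≠ 0 := fun h0 => hc.ne' (C_eq_zero.mp h0)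
    have hinv : (C c * C c⁻¹ : MvPolynomial σ ℝ) = 1 := by
      rw [← C_mul, mul_inv_cancel₀ hc.ne', C_1]
    rcases lt_or_ge k 2 with hk | hk
    · rw [laplacian_eq_zero_of_lt_two hQ hk, mul_zero, eq_comm, neg_eq_zero] at h
      exact (mul_eq_zero.mp h).resolve_left hCc
    · set Q' : MvPolynomial σ ℝ := -(C c⁻¹ * laplacian Q) with hQ'
      have hQ'h : Q'.IsHomogeneous (k - 2) := (hQ.laplacian.C_mul _).neg
      have hQQ' : Q = radiusSq * Q' := by
        have h1 : C c * Q = C c * (radiusSq * Q') := by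
          calc C c * Q = -(radiusSq * laplacian Q) := by rw [h, neg_neg]
            _ = -((C c * C c⁻¹) * (radiusSq * laplacian Q)) := by rw [hinv, one_mul]
            _ = C c * (radiusSq * Q') := by rw [hQ']; ring
        exact mul_left_cancel₀ hCc h1
      have hL : laplacian Q = -(C c * Q') := by
        calc laplacian Q = (C c * C c⁻¹) * laplacian Q := by rw [hinv, one_mul]
          _ = -(C c * Q') := by rw [hQ']; ring
      have hQ'0 : Q' = 0 := by
        refine ih (k - 2) (by omega) (c + (2 * Fintype.card σ + 4 * (k - 2) : ℕ)) Q'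
          (by positivity) hQ'h ?_
        have h2 := laplacian_radiusSq_mul hQ'h
        rw [← hQQ', hL] at h2
        rw [C_add, map_natCast]
        linear_combination -h2
      rw [hQQ', hQ'0, mul_zero]

instance [Finite σ] (k : ℕ) : FiniteDimensional ℝ (homogeneousSubmodule σ ℝ k) :=
  Submodule.finiteDimensional_of_le (S₂ := restrictTotalDegree σ ℝ k) fun _ hP =>
    (mem_restrictTotalDegree _ _ _).mpr (IsHomogeneous.totalDegree_le hP)

/-- Every homogeneous polynomial of degree `k + 2` is the sum of a harmonic one and a multiple of
`|x|²`. -/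
theorem exists_harmonic_add_radiusSq_mul [Nonempty σ] {k : ℕ} {P : MvPolynomial σ ℝ}
    (hP : P.IsHomogeneous (k + 2)) :
    ∃ Y Q : MvPolynomial σ ℝ, Y.IsHomogeneous (k + 2) ∧ laplacian Y = 0 ∧ Q.IsHomogeneous k ∧
      P = Y + radiusSq * Q := by
  have hmaps : ∀ Q ∈ homogeneousSubmodule σ ℝ k,
      (laplacian ∘ₗ LinearMap.mulLeft ℝ radiusSq) Q ∈ homogeneousSubmodule σ ℝ k := by
    intro Q hQ
    have := (isHomogeneous_radiusSq.mul hQ).laplacian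
    rwa [show 2 + k - 2 = k by omega] at this
  set T := (laplacian ∘ₗ LinearMap.mulLeft ℝ (radiusSq : MvPolynomial σ ℝ)).restrict hmaps
  have hinj : Function.Injective T := by
    rw [injective_iff_map_eq_zero]
    intro Q hQ
    have h0 : laplacian (radiusSq * (Q : MvPolynomial σ ℝ)) = 0 := congrArg Subtype.val hQ
    have hQh : (Q : MvPolynomial σ ℝ).IsHomogeneous k := Q.2
    rw [laplacian_radiusSq_mul hQh] at h0
    refine Subtype.ext (eq_zero_of_radiusSq_mul_laplacian k
      ((2 * Fintype.card σ + 4 * k : ℕ) : ℝ) _ ?_ hQh ?_)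
    · have := Fintype.card_pos (α := σ)
      positivity
    · rw [map_natCast]
      linear_combination h0
  have hsurj : Function.Surjective T := LinearMap.injective_iff_surjective.mp hinj
  obtain ⟨Q, hQ⟩ := hsurj ⟨laplacian P, by simpa using hP.laplacian⟩
  have hQ' : laplacian (radiusSq * (Q : MvPolynomial σ ℝ)) = laplacian P := congrArg Subtype.val hQ
  have hQh : (Q : MvPolynomial σ ℝ).IsHomogeneous k := Q.2
  refine ⟨P - radiusSq * (Q : MvPolynomial σ ℝ), Q, hP.sub ?_, ?_, hQh, by ring⟩
  · have := isHomogeneous_radiusSq.mul hQh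
    rwa [add_comm 2 k] at this
  · rw [map_sub, hQ', sub_self]

end Harmonic
end MvPolynomial

/-! ### Dot-product kernels on the sphere -/

section Sphere
open MvPolynomial

variable {d : ℕ}

/-- The restriction of a polynomial to the unit sphere. -/
def sphereRestrict (d : ℕ) : MvPolynomial (Fin d) ℝ →ₐ[ℝ] C(UnitSphere d, ℝ) :=
  aeval fun i => ⟨fun x => x.1 i, by fun_prop⟩

theorem sphereRestrict_X (i : Fin d) (x : UnitSphere d) : sphereRestrict d (X i) x = x.1 i := by
  rw [sphereRestrict, aeval_X]
  rfl

theorem sphereRestrict_apply (P : MvPolynomial (Fin d) ℝ) (x : UnitSphere d) :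
    sphereRestrict d P x = eval (fun i => x.1 i) P := by
  induction P using MvPolynomial.induction_on with
  | C a => simp [sphereRestrict, algHom_C]
  | add P Q hP hQ => simp only [map_add, ContinuousMap.add_apply, hP, hQ]
  | mul_X P i hP => rw [map_mul, ContinuousMap.mul_apply, hP, map_mul, eval_X, sphereRestrict_X]

theorem sum_sq_sphere (x : UnitSphere d) : ∑ i, x.1 i ^ 2 = 1 := by
  have h : ‖x.1‖ = 1 := by simp
  have h2 := EuclideanSpace.norm_sq_eq x.1
  rw [h] at h2
  simpa using h2.symm

theorem sphereRestrict_radiusSq : sphereRestrict d radiusSq = 1 := by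
  ext x
  rw [sphereRestrict_apply, radiusSq]
  simpa using sum_sq_sphere x

/-- The spherical harmonics of degree `k`. -/
def sphericalHarmonics (d k : ℕ) : Submodule ℝ C(UnitSphere d, ℝ) :=
  (homogeneousSubmodule (Fin d) ℝ k ⊓ LinearMap.ker laplacian).map (sphereRestrict d).toLinearMap

instance (k : ℕ) : FiniteDimensional ℝ (sphericalHarmonics d k) := by
  have : FiniteDimensional ℝ
      (homogeneousSubmodule (Fin d) ℝ k ⊓ LinearMap.ker laplacian : Submodule ℝ _) :=
    Submodule.finiteDimensional_of_le inf_le_left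
  unfold sphericalHarmonics
  infer_instance

/-- The restrictions to the sphere of the polynomials of degree at most `m`. -/
def spherePoly (d m : ℕ) : Submodule ℝ C(UnitSphere d, ℝ) :=
  (restrictTotalDegree (Fin d) ℝ m).map (sphereRestrict d).toLinearMap

instance (m : ℕ) : FiniteDimensional ℝ (spherePoly d m) := by
  unfold spherePoly
  infer_instance

theorem sphereRestrict_mem_spherePoly {P : MvPolynomial (Fin d) ℝ} {m : ℕ}
    (hP : P.totalDegree ≤ m) : sphereRestrict d P ∈ spherePoly d m :=
  ⟨P, (mem_restrictTotalDegree _ _ _).mpr hP, rfl⟩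

theorem sphereRestrict_mem_sup [Nonempty (Fin d)] (k : ℕ) : ∀ P : MvPolynomial (Fin d) ℝ,
    P.IsHomogeneous k →
      sphereRestrict d P ∈ (Finset.range (k + 1)).sup (sphericalHarmonics d) := by
  induction k using Nat.strong_induction_on with
  | _ k ih =>
    intro P hP
    have hmem : ∀ Y : MvPolynomial (Fin d) ℝ, Y.IsHomogeneous k → laplacian Y = 0 →
        sphereRestrict d Y ∈ (Finset.range (k + 1)).sup (sphericalHarmonics d) := fun Y h1 h2 =>
      Finset.le_sup (f := sphericalHarmonics d) (Finset.self_mem_range_succ k)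
        ⟨Y, ⟨h1, h2⟩, rfl⟩
    rcases lt_or_ge k 2 with hk | hk
    · exact hmem P hP (laplacian_eq_zero_of_lt_two hP hk)
    · obtain ⟨j, rfl⟩ := Nat.exists_eq_add_of_le' hk
      obtain ⟨Y, Q, hY, hY0, hQ, rfl⟩ := exists_harmonic_add_radiusSq_mul hP
      rw [map_add, map_mul, sphereRestrict_radiusSq, one_mul]
      refine Submodule.add_mem _ (hmem Y hY hY0) ?_
      have hmono : (Finset.range (j + 1)).sup (sphericalHarmonics d) ≤
          (Finset.range (j + 2 + 1)).sup (sphericalHarmonics d) :=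
        Finset.sup_mono (Finset.range_mono (by omega))
      exact hmono (ih j (by omega) Q hQ)

/-- The polynomials of degree at most `m` and the harmonic polynomials of degree at most `m` have
the same restrictions to the sphere. -/
theorem sup_sphericalHarmonics [Nonempty (Fin d)] (m : ℕ) :
    (Finset.range (m + 1)).sup (sphericalHarmonics d) = spherePoly d m := by
  apply le_antisymm
  · refine Finset.sup_le fun k hk => ?_
    rintro _ ⟨Y, ⟨hY, -⟩, rfl⟩
    have h1 : Y.totalDegree ≤ k := IsHomogeneous.totalDegree_le hY
    have := Finset.mem_range.mp hk
    exact sphereRestrict_mem_spherePoly (by omega)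
  · rintro _ ⟨P, hP, rfl⟩
    have hP' := (mem_restrictTotalDegree _ _ _).mp hP
    change sphereRestrict d P ∈ _
    rw [← sum_homogeneousComponent P, map_sum]
    refine Submodule.sum_mem _ fun k hk => ?_
    have := Finset.mem_range.mp hk
    have hmono : (Finset.range (k + 1)).sup (sphericalHarmonics d) ≤
        (Finset.range (m + 1)).sup (sphericalHarmonics d) :=
      Finset.sup_mono (Finset.range_mono (by omega))
    exact hmono (sphereRestrict_mem_sup k _ (homogeneousComponent_isHomogeneous k P))

theorem spherePoly_mul_mem {m : ℕ} {f g : C(UnitSphere d, ℝ)} (hf : f ∈ spherePoly d m)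
    (hg : g ∈ spherePoly d m) : f * g ∈ spherePoly d (2 * m) := by
  obtain ⟨P, hP, rfl⟩ := hf
  obtain ⟨Q, hQ, rfl⟩ := hg
  have hP' := (mem_restrictTotalDegree _ _ _).mp hP
  have hQ' := (mem_restrictTotalDegree _ _ _).mp hQ
  change sphereRestrict d P * sphereRestrict d Q ∈ _
  rw [← map_mul]
  exact sphereRestrict_mem_spherePoly ((totalDegree_mul _ _).trans (by omega))

/-- The action of a linear isometry on the unit sphere. -/
def sphereMap (φ : EuclideanSpace ℝ (Fin d) ≃ₗᵢ[ℝ] EuclideanSpace ℝ (Fin d)) :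
    C(UnitSphere d, UnitSphere d) :=
  ⟨fun x => ⟨φ x.1, by simp⟩, by fun_prop⟩

theorem spherePoly_comp_mem {m : ℕ} {f : C(UnitSphere d, ℝ)} (hf : f ∈ spherePoly d m)
    (φ : EuclideanSpace ℝ (Fin d) ≃ₗᵢ[ℝ] EuclideanSpace ℝ (Fin d)) :
    f.comp (sphereMap φ) ∈ spherePoly d m := by
  obtain ⟨P, hP, rfl⟩ := hf
  have hP' := (mem_restrictTotalDegree _ _ _).mp hP
  -- the coordinates of `φ x` are linear forms in the coordinates of `x`
  set L : Fin d → MvPolynomial (Fin d) ℝ := fun i =>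
    ∑ j, C (φ (EuclideanSpace.single j 1) i) * X j with hL
  have hLh : ∀ i, (L i).IsHomogeneous 1 := fun i =>
    IsHomogeneous.sum _ _ _ fun j _ => isHomogeneous_C_mul_X _ _
  have hLe : ∀ (x : EuclideanSpace ℝ (Fin d)) i, eval (fun j => x j) (L i) = φ x i := by
    intro x i
    have hx : x = ∑ j, x j • EuclideanSpace.single j (1 : ℝ) := by
      ext k
      simp [Finset.sum_apply, Pi.single_apply]
    conv_rhs => rw [hx, map_sum]
    simp [hL, mul_comm]
  have heval : ∀ (P : MvPolynomial (Fin d) ℝ) (x : EuclideanSpace ℝ (Fin d)),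
      eval (fun i => φ x i) P = eval (fun i => x i) (aeval L P) := by
    intro P x
    induction P using MvPolynomial.induction_on with
    | C a => simp [algHom_C]
    | add P Q hP hQ => simp only [map_add, hP, hQ]
    | mul_X P i hP => simp only [map_mul, hP, eval_X, aeval_X, hLe]
  have hcomp : (sphereRestrict d P).comp (sphereMap φ) = sphereRestrict d (aeval L P) := by
    ext x
    rw [ContinuousMap.comp_apply, sphereRestrict_apply, sphereRestrict_apply]
    exact heval P x.1
  change (sphereRestrict d P).comp (sphereMap φ) ∈ _
  rw [hcomp, ← sum_homogeneousComponent P, map_sum, map_sum]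
  refine Submodule.sum_mem _ fun k hk => sphereRestrict_mem_spherePoly ?_
  have h1 := (homogeneousComponent_isHomogeneous k P).aeval L hLh
  have := Finset.mem_range.mp hk
  have := h1.totalDegree_le
  omega

open scoped Pointwise in
theorem measurePreserving_sphereMap
    (φ : EuclideanSpace ℝ (Fin d) ≃ₗᵢ[ℝ] EuclideanSpace ℝ (Fin d)) :
    MeasurePreserving (sphereMap φ) (uniformSphere d) (uniformSphere d) := by
  refine MeasurePreserving.smul_measure ⟨(sphereMap φ).continuous.measurable, ?_⟩ _
  ext s hs
  have hm : Measurable (sphereMap φ) := (sphereMap φ).continuous.measurable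
  rw [Measure.map_apply hm hs, Measure.toSphere_apply' _ hs, Measure.toSphere_apply' _ (hm hs)]
  congr 1
  rw [← φ.measurePreserving.measure_preimage_emb φ.toHomeomorph.measurableEmbedding
    (Set.Ioo (0 : ℝ) 1 • (Subtype.val '' s))]
  congr 1
  ext z
  simp only [Set.mem_preimage, Set.mem_smul, Set.mem_image]
  constructor
  · rintro ⟨r, hr, _, ⟨y, hy, rfl⟩, rfl⟩
    exact ⟨r, hr, φ y.1, ⟨sphereMap φ y, hy, rfl⟩, (map_smul φ r y.1).symm⟩
  · rintro ⟨r, hr, _, ⟨y, hy, rfl⟩, hz⟩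
    have hy' : sphereMap φ (sphereMap φ.symm y) = y :=
      Subtype.ext (φ.apply_symm_apply y.1)
    refine ⟨r, hr, φ.symm y.1, ⟨sphereMap φ.symm y, by rwa [hy'], rfl⟩, ?_⟩
    apply φ.injective
    rw [map_smul, φ.apply_symm_apply]
    exact hz

instance [NeZero d] : IsProbabilityMeasure (uniformSphere d) := by
  have : Nonempty (Fin d) := ⟨0⟩
  refine ⟨?_⟩
  rw [uniformSphere, Measure.smul_apply, smul_eq_mul]
  refine ENNReal.inv_mul_cancel ?_ (measure_ne_top _ _)
  rw [Ne, Measure.measure_univ_eq_zero]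
  exact Measure.toSphere_ne_zero _

instance [NeZero d] : (uniformSphere d).IsOpenPosMeasure :=
  Measure.isOpenPosMeasure_smul _ (ENNReal.inv_ne_zero.mpr (measure_ne_top _ _))

theorem exists_isometry_sphere (x y : UnitSphere d) :
    ∃ φ : EuclideanSpace ℝ (Fin d) ≃ₗᵢ[ℝ] EuclideanSpace ℝ (Fin d), sphereMap φ x = y := by
  refine ⟨(ℝ ∙ (x.1 - y.1))ᗮ.reflection, Subtype.ext ?_⟩
  have hx : ‖x.1‖ = 1 := by simp
  have hy : ‖y.1‖ = 1 := by simp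
  exact Submodule.reflection_sub (hx.trans hy.symm)

/-- Polynomials in all coordinates but the first one are determined by their restrictions to the
sphere. -/
theorem finrank_le_finrank_spherePoly (e j : ℕ) :
    Module.finrank ℝ (restrictTotalDegree (Fin e) ℝ j) ≤
      Module.finrank ℝ (spherePoly (e + 1) j) := by
  set T : MvPolynomial (Fin e) ℝ →ₗ[ℝ] C(UnitSphere (e + 1), ℝ) :=
    ((sphereRestrict (e + 1)).comp (rename Fin.succ)).toLinearMap with hT
  have hinj : Function.Injective T := by
    rw [injective_iff_map_eq_zero]
    intro p hp
    refine funext_set (fun _ => Set.Icc (0 : ℝ) (1 / (e + 1))) (fun _ => ?_) fun y hy => ?_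
    · exact Set.Icc_infinite (by positivity)
    · have hsum : ∑ i, y i ^ 2 ≤ 1 := by
        have h1 : ∀ i ∈ Finset.univ, y i ^ 2 ≤ 1 / (e + 1 : ℝ) := fun i _ => by
          have h2 := hy i (Set.mem_univ i)
          have h3 : (1 : ℝ) / (e + 1) ≤ 1 := by
            rw [div_le_one (by positivity)]; linarith [(Nat.cast_nonneg e : (0 : ℝ) ≤ e)]
          nlinarith [h2.1, h2.2]
        refine (Finset.sum_le_card_nsmul _ _ _ h1).trans ?_
        rw [Finset.card_univ, Fintype.card_fin, nsmul_eq_mul, mul_one_div,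
          div_le_one (by positivity)]
        linarith
      have hx : ‖(WithLp.toLp 2 (Fin.cons (Real.sqrt (1 - ∑ i, y i ^ 2)) y) :
          EuclideanSpace ℝ (Fin (e + 1)))‖ = 1 := by
        rw [EuclideanSpace.norm_eq, Fin.sum_univ_succ]
        simp [Real.sq_sqrt (sub_nonneg.mpr hsum)]
      have h4 := congrArg (fun f : C(UnitSphere (e + 1), ℝ) => f ⟨_, by simpa using hx⟩) hp
      simp only [hT, AlgHom.toLinearMap_apply, AlgHom.comp_apply, sphereRestrict_apply,
        eval_rename] at h4
      rw [map_zero]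
      exact h4
  rw [(Submodule.equivMapOfInjective T hinj (restrictTotalDegree (Fin e) ℝ j)).finrank_eq]
  refine Submodule.finrank_mono ?_
  rintro _ ⟨p, hp, rfl⟩
  exact sphereRestrict_mem_spherePoly
    ((totalDegree_rename_le _ _).trans ((mem_restrictTotalDegree _ _ _).mp hp))

/-- Writing an exponent as `2 β + ε` with `ε ∈ {0, 1}^d` and eliminating the square of the first
coordinate, a polynomial of degree at most `2 j + 1` on the sphere becomes a combination of the
`2^d` squarefree monomials with coefficients that are polynomials of degree at most `j` in the
squares of the other coordinates. -/
theorem finrank_spherePoly_le (e j : ℕ) :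
    Module.finrank ℝ (spherePoly (e + 1) (2 * j + 1)) ≤
      2 ^ (e + 1) * Module.finrank ℝ (restrictTotalDegree (Fin e) ℝ j) := by
  classical
  set S : MvPolynomial (Fin e) ℝ →ₐ[ℝ] C(UnitSphere (e + 1), ℝ) :=
    (sphereRestrict (e + 1)).comp (aeval fun i : Fin e => X i.succ ^ 2) with hS
  set T : (Finset (Fin (e + 1)) → restrictTotalDegree (Fin e) ℝ j) →ₗ[ℝ]
      C(UnitSphere (e + 1), ℝ) :=
    ∑ ε : Finset (Fin (e + 1)), (LinearMap.mulLeft ℝ (sphereRestrict (e + 1) (∏ i ∈ ε, X i))) ∘ₗ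
      S.toLinearMap ∘ₗ (restrictTotalDegree (Fin e) ℝ j).subtype ∘ₗ LinearMap.proj ε with hT
  have hTapply : ∀ p, T p = ∑ ε : Finset (Fin (e + 1)),
      sphereRestrict (e + 1) (∏ i ∈ ε, X i) * S (p ε : MvPolynomial (Fin e) ℝ) := fun p => by
    simp [hT, LinearMap.sum_apply]
  have hle : spherePoly (e + 1) (2 * j + 1) ≤ LinearMap.range T := by
    rintro _ ⟨P, hP, rfl⟩
    have hP' := (mem_restrictTotalDegree _ _ _).mp hP
    change sphereRestrict (e + 1) P ∈ _
    rw [P.as_sum, map_sum]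
    refine Submodule.sum_mem _ fun α hα => ?_
    have hdeg : ∑ i, α i ≤ 2 * j + 1 := by
      have := (le_totalDegree hα).trans hP'
      rwa [Finsupp.sum_fintype _ _ fun _ => rfl] at this
    rw [← mul_one (coeff α P), ← smul_eq_mul, ← smul_monomial, map_smul]
    refine Submodule.smul_mem _ _ ?_
    set ε : Finset (Fin (e + 1)) := Finset.univ.filter fun i => α i % 2 = 1 with hε
    -- the squares of the coordinates as polynomials in the squares of all but the first one
    set u : Fin (e + 1) → MvPolynomial (Fin e) ℝ := Fin.cons (1 - ∑ i, X i) X with hu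
    have hudeg : ∀ i, (u i).totalDegree ≤ 1 := by
      intro i
      refine Fin.cases ?_ (fun i => ?_) i
      · rw [hu, Fin.cons_zero]
        refine (totalDegree_sub _ _).trans (max_le (by simp) ?_)
        exact totalDegree_finsetSum_le fun i _ => (totalDegree_X i).le
      · rw [hu, Fin.cons_succ]
        exact (totalDegree_X i).le
    have hSu : ∀ i, S (u i) = sphereRestrict (e + 1) (X i ^ 2) := by
      intro i
      refine Fin.cases ?_ (fun i => ?_) i
      · have h1 : (radiusSq : MvPolynomial (Fin (e + 1)) ℝ) =
            X 0 ^ 2 + ∑ i : Fin e, X i.succ ^ 2 := by rw [radiusSq, Fin.sum_univ_succ]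
        have h2 := sphereRestrict_radiusSq (d := e + 1)
        rw [h1, map_add] at h2
        rw [hu, Fin.cons_zero, hS, AlgHom.comp_apply, map_sub, map_one, map_sub, map_one,
          map_sum]
        simp only [aeval_X]
        rw [← h2, add_sub_cancel_right]
      · rw [hu, Fin.cons_succ, hS, AlgHom.comp_apply, aeval_X]
    have hpdeg : (∏ i, u i ^ (α i / 2)).totalDegree ≤ j := by
      refine (totalDegree_finsetProd _ _).trans ?_
      have h1 : ∑ i, (u i ^ (α i / 2)).totalDegree ≤ ∑ i, α i / 2 :=
        Finset.sum_le_sum fun i _ => (totalDegree_pow _ _).trans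
          ((Nat.mul_le_mul_left _ (hudeg i)).trans_eq (mul_one _))
      have h2 : 2 * ∑ i, α i / 2 ≤ ∑ i, α i := by
        rw [Finset.mul_sum]
        exact Finset.sum_le_sum fun i _ => Nat.mul_div_le _ _
      omega
    refine ⟨Pi.single ε ⟨_, (mem_restrictTotalDegree _ _ _).mpr hpdeg⟩, ?_⟩
    rw [hTapply, Finset.sum_eq_single_of_mem ε (Finset.mem_univ _)]
    · rw [Pi.single_eq_same]
      change _ * S (∏ i, u i ^ (α i / 2)) = _
      have hmon : (monomial α 1 : MvPolynomial (Fin (e + 1)) ℝ) = ∏ i, X i ^ α i := by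
        rw [monomial_eq, C_1, one_mul, Finsupp.prod_fintype]
        exact fun i => pow_zero _
      rw [hmon, map_prod, map_prod, map_prod, hε, Finset.prod_filter, ← Finset.prod_mul_distrib]
      refine Finset.prod_congr rfl fun i _ => ?_
      rw [map_pow, hSu, map_pow, map_pow, ← pow_mul]
      split_ifs with h
      · rw [← pow_succ']
        congr 1
        omega
      · rw [one_mul]
        congr 1
        omega
    · intro ε' _ hne
      rw [Pi.single_eq_of_ne hne, Submodule.coe_zero, map_zero, mul_zero]
  calc _ ≤ Module.finrank ℝ (LinearMap.range T) := Submodule.finrank_mono hle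
    _ ≤ Module.finrank ℝ (Finset (Fin (e + 1)) → restrictTotalDegree (Fin e) ℝ j) :=
      LinearMap.finrank_range_le T
    _ = _ := by
      rw [Module.finrank_pi_fintype]
      simp

theorem le_finrank_restrictTotalDegree (e j : ℕ) :
    j + 1 ≤ Module.finrank ℝ (restrictTotalDegree (Fin (e + 1)) ℝ j) := by
  have hlin : LinearIndependent ℝ fun k : Fin (j + 1) =>
      (X 0 ^ (k : ℕ) : MvPolynomial (Fin (e + 1)) ℝ) := by
    have h := (basisMonomials (Fin (e + 1)) ℝ).linearIndependent.comp
      (fun k : Fin (j + 1) => Finsupp.single (0 : Fin (e + 1)) (k : ℕ)) fun a b hab =>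
        Fin.ext (Finsupp.single_injective _ hab)
    have e : (fun k : Fin (j + 1) => (X 0 ^ (k : ℕ) : MvPolynomial (Fin (e + 1)) ℝ)) =
        basisMonomials (Fin (e + 1)) ℝ ∘ fun k : Fin (j + 1) => Finsupp.single 0 (k : ℕ) := by
      funext k
      simp [X_pow_eq_monomial]
    rw [e]
    exact h
  have h1 := finrank_span_eq_card hlin
  rw [Fintype.card_fin] at h1
  rw [← h1]
  refine Submodule.finrank_mono (Submodule.span_le.mpr ?_)
  rintro _ ⟨k, rfl⟩
  refine (mem_restrictTotalDegree _ _ _).mpr ?_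
  rw [totalDegree_X_pow]
  have := k.2
  omega

theorem PSDKernel.le_ballErrorSq_sphere (e : ℕ) {K : PSDKernel (UnitSphere (e + 2))} {ev : ℕ → ℝ}
    (hev : HasHarmonicEigenvalues K ev) (hanti : Antitone ev)
    {n : ℕ} (hn : 0 < n) {q : UnitSphere (e + 2) → ℝ} {x : Fin n → UnitSphere (e + 2)}
    (hq : ∀ i, 0 < q (x i)) {lam : ℝ} (hlam : 0 ≤ lam) (s : ℝ) {p : ℝ} (hp : p ≤ 2)
    (h2 : p = 2 → 0 < K.eigenvalue (uniformSphere (e + 2)) (2 * 2 ^ (e + 2) * n)) :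
    ENNReal.ofReal
        (1 / 2 * K.eigenvalue (uniformSphere (e + 2)) (2 * 2 ^ (e + 2) * n) ^ (2 - p)) ≤
      K.ballErrorSq (uniformSphere (e + 2)) q x lam s p
        (K.eigenvalue (uniformSphere (e + 2)) 1 ^ (2 - s)) := by
  refine K.le_ballErrorSq (uniformSphere (e + 2)) (H := sphericalHarmonics (e + 2)) (ev := ev)
    ?_ hanti ?_ ?_ ?_ ?_ ?_ (by positivity) ?_ hn hq hlam s hp h2
  · rintro k _ ⟨Y, ⟨hY, hY0⟩, rfl⟩ x
    have h := hev k Y hY (by rw [← laplacian_apply]; exact hY0) x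
    simp only [AlgHom.toLinearMap_apply, sphereRestrict_apply]
    exact h
  · intro x y hxy
    by_contra! hcon
    refine hxy (Subtype.ext (PiLp.ext fun i => ?_))
    have h := hcon 1 (sphereRestrict (e + 2) (X i)) ⟨X i, ⟨isHomogeneous_X _ _,
      laplacian_eq_zero_of_lt_two (isHomogeneous_X _ _) (by norm_num)⟩, rfl⟩
    simpa [sphereRestrict_apply] using h
  · apply le_antisymm
    · rintro _ ⟨Y, ⟨hY, -⟩, rfl⟩
      have h := totalDegree_eq_zero_iff_eq_C.mp (Nat.le_zero.mp (IsHomogeneous.totalDegree_le hY))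
      rw [h]
      refine Submodule.mem_span_singleton.mpr ⟨coeff 0 Y, ?_⟩
      ext x
      simp
    · rw [Submodule.span_singleton_le_iff_mem]
      exact ⟨1, ⟨isHomogeneous_one _ _, laplacian_eq_zero_of_lt_two (isHomogeneous_one _ _)
        (by norm_num)⟩, map_one (sphereRestrict (e + 2))⟩
  · intro m f hf g hg
    rw [sup_sphericalHarmonics] at hf hg ⊢
    exact spherePoly_mul_mem hf hg
  · intro x y
    obtain ⟨φ, hφ⟩ := exists_isometry_sphere x y
    refine ⟨sphereMap φ, hφ, measurePreserving_sphereMap φ, fun m f hf => ?_⟩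
    rw [sup_sphericalHarmonics] at hf ⊢
    exact spherePoly_comp_mem hf φ
  · intro N
    refine ⟨N, ?_⟩
    rw [sup_sphericalHarmonics]
    exact ((Nat.le_succ N).trans (le_finrank_restrictTotalDegree e N)).trans
      (finrank_le_finrank_spherePoly (e + 1) N)
  · intro m
    rw [sup_sphericalHarmonics, sup_sphericalHarmonics]
    exact (finrank_spherePoly_le (e + 1) m).trans
      (Nat.mul_le_mul_left _ (finrank_le_finrank_spherePoly (e + 1) m))

end Sphere

end

theorem mainTheorem6 :
    -- dot-product kernels on the sphere `𝕊^{d-1}`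
    (∀ d : ℕ, 2 ≤ d → ∃ C : ℕ, 0 < C ∧
      ∀ (K : PSDKernel (UnitSphere d)) (κ : ℝ → ℝ),
        (∀ x y : UnitSphere d, K.toFun x y = κ (inner ℝ x.1 y.1)) →
      ∀ (n : ℕ) (x : Fin n → UnitSphere d) (q : UnitSphere d → ℝ) (p s lam : ℝ),
        0 < n → (∀ i, 0 < q (x i)) → 0 ≤ p → p ≤ 2 → 2 < s → 0 ≤ lam →
        (p = 2 → 0 < K.eigenvalue (uniformSphere d) (C * n)) →
        ENNReal.ofReal (1 / 2 * K.eigenvalue (uniformSphere d) (C * n) ^ (2 - p)) ≤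
          K.supErrorSq (uniformSphere d) q x lam s p ∧
        ((∃ ev : ℕ → ℝ, HasHarmonicEigenvalues K ev ∧ Antitone ev) →
          ENNReal.ofReal (1 / 2 * K.eigenvalue (uniformSphere d) (C * n) ^ (2 - p)) ≤
            K.ballErrorSq (uniformSphere d) q x lam s p
              (K.eigenvalue (uniformSphere d) 1 ^ (2 - s)))) ∧
    -- periodic kernels on the torus `𝕋 = ℝ/ℤ`
    (∃ C : ℕ, 0 < C ∧
      ∀ (K : PSDKernel UnitAddCircle) (κ : UnitAddCircle → ℝ),
        (∀ x y : UnitAddCircle, K.toFun x y = κ (x - y)) →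
      ∀ (n : ℕ) (x : Fin n → UnitAddCircle) (q : UnitAddCircle → ℝ) (p s lam : ℝ),
        0 < n → (∀ i, 0 < q (x i)) → 0 ≤ p → p ≤ 2 → 2 < s → 0 ≤ lam →
        (p = 2 → 0 < K.eigenvalue AddCircle.haarAddCircle (C * n)) →
        ENNReal.ofReal (1 / 2 * K.eigenvalue AddCircle.haarAddCircle (C * n) ^ (2 - p)) ≤
          K.supErrorSq AddCircle.haarAddCircle q x lam s p ∧
        (Antitone (periodicEigenvalue κ) →
          ENNReal.ofReal (1 / 2 * K.eigenvalue AddCircle.haarAddCircle (C * n) ^ (2 - p)) ≤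
            K.ballErrorSq AddCircle.haarAddCircle q x lam s p
              (K.eigenvalue AddCircle.haarAddCircle 1 ^ (2 - s)))) := by
  constructor
  · intro d hd
    obtain ⟨e, rfl⟩ := Nat.exists_eq_add_of_le' hd
    -- twice a bound for the factor by which the dimension grows from degree `j` to degree `2 j + 1`
    refine ⟨2 * 2 ^ (e + 2), by positivity, ?_⟩
    intro K κ _ n x q p s lam hn hq _ hp2 _ hlam h2
    have hlt : n < 2 * 2 ^ (e + 2) * n := by
      have : 1 < 2 * 2 ^ (e + 2) := by
        have : 0 < 2 ^ (e + 2) := by positivity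
        omega
      exact lt_mul_of_one_lt_left hn this
    refine ⟨K.le_supErrorSq _ hq hlam s hlt h2, ?_⟩
    rintro ⟨ev, hev, hanti⟩
    exact PSDKernel.le_ballErrorSq_sphere e hev hanti hn hq hlam s hp2 h2
  · -- again twice a bound for this factor, which is at most `4`
    refine ⟨8, by norm_num, ?_⟩
    intro K κ hK n x q p s lam hn hq _ hp2 _ hlam h2
    exact ⟨K.le_supErrorSq _ hq hlam s (by omega) h2, fun hanti =>
      PSDKernel.le_ballErrorSq_torus hK hanti hn hq hlam s hp2 h2⟩
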